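/- Work over $\mathbb C$. Let $\mathcal L$ be a twisted affine Lie superalgebra of one of the types $A(2m,2n-1)^{(2)}$ ($m\ge 0$, $n\ge 1$), $A(2m-1,2n-1)^{(2)}$ ($m,n\ge 1$, $(m,n)\neq(1,1)$), $A(2m,2n)^{(4)}$ ($m,n\ge 0$, $(m,n)\ne(0,0)$), $D(m+1,n)^{(2)}$ ($m\ge 0$, $n\ge 1$). That is, let $\mathscr T$ be the basic classical simple Lie superalgebra of type $A(2m,2n-1)$, $A(2m-1,2n-1)$, $A(2m,2n)$ or $D(m+1,n)$ respectively, $\sigma$ its diagram automorphism, of order $l=2$ (resp. $l=4$ for $A(2m,2n)^{(4)}$), with fixed point superalgebra $\mathfrak{osp}(2m+1|2n)$, $\mathfrak{osp}(2m|2n)$, $\mathfrak{osp}(2m+1|2n)$, $\mathfrak{osp}(2m+1|2n)$ respectively, let $\zeta$ be a primitive $l$-th root of unity, and $$\mathcal L=\bigoplus_{k\in\mathbb Z}\{x\in\mathscr T:\sigma(x)=\zeta^kx\}\otimes t^k\;\oplus\;\mathbb Cc\oplus\mathbb Cd,$$ $$[x\otimes t^p+rc+sd,\;y\otimes t^q+r'c+s'd]=[x,y]\otimes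 t^{p+q}+p(x,y)\delta_{p+q,0}c+sq\,y\otimes t^q-s'p\,x\otimes t^p .$$ Let $\mathcal H=\mathfrak h\oplus\mathbb Cc\oplus\mathbb Cd$ be the standard Cartan subalgebra, where $\mathfrak h$ is the fixed point subalgebra under $\sigma$ of the standard Cartan subalgebra of $\mathscr T$. Let $R\subseteq\mathcal H^*$ be the root system of $\mathcal L$ with respect to $\mathcal H$ (with $0\in R$), let $(\cdot,\cdot)$ be the form on $\mathcal H^*$ induced by the invariant form on $\mathcal L$, let $\delta\in\mathcal H^*$ be given by $\delta(d)=1$, $\delta(\mathfrak h\oplus\mathbb Cc)=0$, and put $R_{re}=\{\alpha\in R:(\alpha,\alpha)\ne0\}$. Identify $\mathfrak h^*$ with the space of elements of $\mathcal H^*$ vanishing on $\mathbb Cc\oplus\mathbb Cd$, and put $\dot R=\{\dot\alpha\in\mathfrak h^*:(\dot\alpha+\mathbb Z\delta)\cap R\ne\emptyset\}$, $\dot R_{re}=\{\dot\alpha\in\dot R:(\dot\alpha,\dot\alpha)\neq0\}$. A finite weight $\mathcal L$-module is a superspace $V=V_0\oplus V_1$ with a $\mathbb Z_2$-graded $\mathcal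 L$-module structure such that $V=\bigoplus_{\lambda\in\mathcal H^*}V^\lambda$ with all weight spaces $V^\lambda=\{v: hv=\lambda(h)v\ (h\in\mathcal H)\}$ finite dimensional; $\mathrm{supp}(V)=\{\lambda: V^\lambda\neq0\}$. It is simple if it is nonzero and has no proper nonzero ($\mathbb Z_2$-graded) submodule; it has zero level if $c$ acts as $0$. Let $R^{ln}(V)$ (resp. $R^{in}(V)$) be the set of $\alpha\in R_{re}$ such that the nonzero elements of $\mathcal L^\alpha$ act on $V$ locally nilpotently (resp. injectively). Let $\dot\beta\in\dot R_{re}$. - $\dot\beta$ is full-locally nilpotent if $(\dot\beta+\mathbb Z\delta)\cap R\subseteq R^{ln}(V)$. - $\dot\beta$ is down-nilpotent hybrid if there are $r\in\mathbb Z$ and $t\in\{0,1,-1\}$ such that, for $\gamma=\dot\beta+r\delta$: $(\gamma+\mathbb Z^{\ge1}\delta)\cap R\subseteq R^{in}(V)$, $(\gamma+\mathbb Z^{\le0}\delta)\cap R\subseteq R^{ln}(V)$, $(-\gamma+\mathbb Z^{\ge t}\delta)\cap R\subseteq R^{in}(V)$ and $(-\gamma+\mathbb Z^{\le t-1}\delta)\cap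 R\subseteq R^{ln}(V)$. - $\dot\beta$ is up-nilpotent hybrid if there are $r\in\mathbb Z$ and $t\in\{0,1,-1\}$ such that, for $\eta=\dot\beta+r\delta$: $(\eta+\mathbb Z^{\le-1}\delta)\cap R\subseteq R^{in}(V)$, $(\eta+\mathbb Z^{\ge0}\delta)\cap R\subseteq R^{ln}(V)$, $(-\eta+\mathbb Z^{\le-t}\delta)\cap R\subseteq R^{in}(V)$ and $(-\eta+\mathbb Z^{\ge1-t}\delta)\cap R\subseteq R^{ln}(V)$. - $\dot\beta$ is hybrid if it is down-nilpotent hybrid or up-nilpotent hybrid. **Lemma.** Let $V$ be a zero level simple finite weight $\mathcal L$-module. Let $\varrho\in\{1,2\}$ and $\dot\alpha,\dot\beta\in\frac1\varrho\dot R$ with $(\dot\alpha,\dot\beta)=0$. Suppose that $\varrho\dot\alpha$ and $-\varrho\dot\alpha$ are full-locally nilpotent, and that each of $\varrho\dot\beta$ and $-\varrho\dot\beta$ is hybrid or full-locally nilpotent. Then there are no $\mu\in\mathrm{supp}(V)$ and integers $m_s$ $(s\in\mathbb Z^{>0})$ such that $\mu+s(\dot\alpha+\dot\beta)+m_s\delta\in\mathrm{supp}(V)$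 for all $s\in\mathbb Z^{>0}$. -/

import Mathlib

/-!
Twisted affine Lie superalgebras with nonzero odd part, built from matrices, and their
weight modules.

All four families are treated together.  The vector space underlying the defining
representation has a basis indexed by `Idx X m n`: pairs `e_i, e_{-i}` (`i < m`, even),
pairs `f_p, f_{-p}` (`p < n`, odd), and `X.extraEven` further even and `X.extraOdd` further
odd basis vectors.
-/

noncomputable section

namespace TwistedAffine

/-- The four families of twisted affine Lie superalgebras with nonzero odd part:
`AEO` is `A(2m,2n-1)^(2)`, `AOO` is `A(2m-1,2n-1)^(2)`, `AEE` is `A(2m,2n)^(4)`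
and `DD` is `D(m+1,n)^(2)`. -/
inductive Family
  | AEO
  | AOO
  | AEE
  | DD

/-- The admissible ranks of each family. -/
def Family.Admissible : Family → ℕ → ℕ → Prop
  | .AEO, _, n => n ≠ 0
  | .AOO, m, n => m ≠ 0 ∧ n ≠ 0 ∧ (m, n) ≠ (1, 1)
  | .AEE, m, n => (m, n) ≠ (0, 0)
  | .DD, _, n => n ≠ 0

def Family.extraEven : Family → ℕ
  | .AEO => 1
  | .AOO => 0
  | .AEE => 1
  | .DD => 2

def Family.extraOdd : Family → ℕ
  | .AEE => 1
  | _ => 0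

/-- The primitive root of unity `ζ` of order `l`, where `l` is the order of the diagram
automorphism (`l = 4` for `A(2m,2n)^(4)` and `l = 2` otherwise). -/
def Family.rootOfUnity : Family → ℂ
  | .AEE => Complex.I
  | _ => -1

theorem Family.rootOfUnity_ne_zero (X : Family) : X.rootOfUnity ≠ 0 := by
  cases X <;> simp [Family.rootOfUnity]

/-! ### General linear Lie superalgebras -/

/-- The sign `(-1)^a` for `a : ZMod 2`. -/
def sgn (a : ZMod 2) : ℂ := if a = 0 then 1 else -1

abbrev Idx (X : Family) (m n : ℕ) : Type :=
  (Fin m ⊕ Fin m ⊕ Fin X.extraEven) ⊕ (Fin n ⊕ Fin n ⊕ Fin X.extraOdd)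

variable {X : Family} {m n : ℕ}

/-- Parity of a basis vector. -/
def par : Idx X m n → ZMod 2
  | .inl _ => 0
  | .inr _ => 1

variable (X m n) in
abbrev Mat : Type := Matrix (Idx X m n) (Idx X m n) ℂ

/-- The supercommutator: on homogeneous matrices, `x * y - (-1)^(|x||y|) y * x`. -/
def matBracket : Mat X m n →ₗ[ℂ] Mat X m n →ₗ[ℂ] Mat X m n :=
  LinearMap.mk₂ ℂ
    (fun x y => Matrix.of fun i j =>
      ∑ k, (x i k * y k j - sgn ((par i + par k) * (par k + par j)) * (y i k * x k j)))
    (by intro x x' y; ext i j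
        simp only [Matrix.of_apply, Matrix.add_apply, ← Finset.sum_add_distrib]
        exact Finset.sum_congr rfl fun k _ => by ring)
    (by intro c x y; ext i j
        simp only [Matrix.of_apply, Matrix.smul_apply, smul_eq_mul, Finset.mul_sum]
        exact Finset.sum_congr rfl fun k _ => by ring)
    (by intro x y y'; ext i j
        simp only [Matrix.of_apply, Matrix.add_apply, ← Finset.sum_add_distrib]
        exact Finset.sum_congr rfl fun k _ => by ring)
    (by intro c x y; ext i j
        simp only [Matrix.of_apply, Matrix.smul_apply, smul_eq_mul, Finset.mul_sum]
        exact Finset.sum_congr rfl fun k _ => by ring)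

theorem matBracket_apply (x y : Mat X m n) (i j : Idx X m n) :
    matBracket x y i j =
      ∑ k, (x i k * y k j - sgn ((par i + par k) * (par k + par j)) * (y i k * x k j)) := rfl

/-- The matrices that are homogeneous of degree `a`. -/
def matPart (a : ZMod 2) : Submodule ℂ (Mat X m n) where
  carrier := {x | ∀ i j, par i + par j ≠ a → x i j = 0}
  add_mem' := by
    intro x y hx hy i j h
    simp [hx i j h, hy i j h]
  zero_mem' := by intro i j _; rfl
  smul_mem' := by
    intro c x hx i j h
    simp [hx i j h]

/-- The supertrace. -/
def str : Mat X m n →ₗ[ℂ] ℂ where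
  toFun x := ∑ i, sgn (par i) * x i i
  map_add' x y := by simp [mul_add, Finset.sum_add_distrib]
  map_smul' c x := by
    simp only [Matrix.smul_apply, smul_eq_mul, RingHom.id_apply, Finset.mul_sum]
    exact Finset.sum_congr rfl fun k _ => by ring

theorem str_apply (x : Mat X m n) : str x = ∑ i, sgn (par i) * x i i := rfl

/-- The supertranspose. -/
def superTranspose (x : Mat X m n) : Mat X m n :=
  Matrix.of fun i j => sgn ((par i + par j) * par i) * x j i

/-- The involution of the basis that pairs `e_i` with `e_{-i}` and `f_p` with `f_{-p}`. -/
def opp : Idx X m n → Idx X m n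
  | .inl (.inl i) => .inl (.inr (.inl i))
  | .inl (.inr (.inl i)) => .inl (.inl i)
  | .inl (.inr (.inr z)) => .inl (.inr (.inr z.rev))
  | .inr (.inl p) => .inr (.inr (.inl p))
  | .inr (.inr (.inl p)) => .inr (.inl p)
  | .inr (.inr (.inr u)) => .inr (.inr (.inr u.rev))

def formSign : Idx X m n → ℂ
  | .inr (.inr (.inl _)) => -1
  | _ => 1

/-- The Gram matrix of the even bilinear form on the defining representation.  It is symmetric
on the even part, and on the odd part it is skew-symmetric on the span of the `f_p, f_{-p}`
and symmetric on the extra odd vector (if there is one). -/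
def gram : Mat X m n := Matrix.of fun i j => if j = opp i then formSign i else 0

/-- The map `x ↦ -x*`, where `x*` is the superadjoint of `x` with respect to the form with Gram
matrix `gram` (a signed permutation matrix, so that its inverse is its transpose). -/
def negAdjoint : Mat X m n →ₗ[ℂ] Mat X m n where
  toFun x := -(gram.transpose * superTranspose x * gram)
  map_add' x y := by
    have h : superTranspose (x + y) = superTranspose x + superTranspose y := by
      ext i j; simp [superTranspose, mul_add]
    rw [h, Matrix.mul_add, Matrix.add_mul, neg_add]
  map_smul' c x := by
    have h : superTranspose (c • x) = c • superTranspose x := by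
      ext i j; simp [superTranspose]; ring
    rw [h, Matrix.mul_smul, Matrix.smul_mul, RingHom.id_apply, smul_neg]

/-- The involution of the basis that interchanges the two extra even vectors (if there are
two) and fixes all other basis vectors. -/
def flip : Idx X m n → Idx X m n
  | .inl (.inr (.inr z)) => .inl (.inr (.inr z.rev))
  | i => i

@[simp] theorem opp_opp (i : Idx X m n) : opp (opp i) = i := by
  rcases i with (i | i | i) | (i | i | i) <;> simp [opp]

@[simp] theorem flip_flip (i : Idx X m n) : flip (flip i) = i := by
  rcases i with (i | i | i) | (i | i | i) <;> simp [flip]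

theorem opp_flip (i : Idx X m n) : opp (flip i) = flip (opp i) := by
  rcases i with (i | i | i) | (i | i | i) <;> simp [flip, opp]

@[simp] theorem par_opp (i : Idx X m n) : par (opp i) = par i := by
  rcases i with (i | i | i) | (i | i | i) <;> rfl

@[simp] theorem par_flip (i : Idx X m n) : par (flip i) = par i := by
  rcases i with (i | i | i) | (i | i | i) <;> rfl

@[simp] theorem formSign_flip (i : Idx X m n) : formSign (flip i) = formSign i := by
  rcases i with (i | i | i) | (i | i | i) <;> rfl

theorem formSign_mul_self (i : Idx X m n) : formSign i * formSign i = 1 := by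
  rcases i with (i | i | i) | (i | i | i) <;> simp [formSign]

def oppEquiv : Idx X m n ≃ Idx X m n := ⟨opp, opp, opp_opp, opp_opp⟩

def flipEquiv : Idx X m n ≃ Idx X m n := ⟨flip, flip, flip_flip, flip_flip⟩

theorem negAdjoint_apply (x : Mat X m n) (i j : Idx X m n) :
    negAdjoint x i j = -(formSign (opp i) * formSign (opp j) *
      sgn ((par i + par j) * par i) * x (opp j) (opp i)) := by
  have e : ∀ k i : Idx X m n, (i = opp k) ↔ (k = opp i) := by
    intro k i
    constructor <;> (rintro rfl; simp)
  simp only [negAdjoint, gram, superTranspose, LinearMap.coe_mk, AddHom.coe_mk,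
    Matrix.neg_apply, Matrix.mul_apply, Matrix.transpose_apply, Matrix.of_apply, e _ i, e _ j]
  simp
  ring

theorem sgn_mul_self (a : ZMod 2) : sgn a * sgn a = 1 := by
  unfold sgn; split_ifs <;> norm_num

theorem zmod_two_cases (a : ZMod 2) : a = 0 ∨ a = 1 := by
  revert a; decide

theorem formSign_cases (i : Idx X m n) : formSign i = 1 ∨ formSign i = -1 := by
  rcases i with (i | i | i) | (i | i | i) <;> simp [formSign]

theorem negAdjoint_bracket (x y : Mat X m n) :
    negAdjoint (matBracket x y) = matBracket (negAdjoint x) (negAdjoint y) := by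
  ext i j
  rw [negAdjoint_apply, matBracket_apply, matBracket_apply,
    ← Equiv.sum_comp (oppEquiv (X := X) (m := m) (n := n)), Finset.mul_sum,
    ← Finset.sum_neg_distrib]
  refine Finset.sum_congr rfl fun k _ => ?_
  simp only [negAdjoint_apply, oppEquiv, Equiv.coe_fn_mk, par_opp]
  have e1 : (1 + 1 : ZMod 2) = 0 := by decide
  have e2 : sgn 0 = 1 := by simp [sgn]
  have e3 : sgn 1 = -1 := by simp [sgn]
  rcases zmod_two_cases (par i) with hi | hi <;> rcases zmod_two_cases (par j) with hj | hj <;>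
    rcases zmod_two_cases (par k) with hp | hp <;>
    rcases formSign_cases (opp k) with hk | hk <;>
    simp only [hi, hj, hp, hk, e1, e2, e3, add_zero, zero_add, mul_zero, mul_one] <;>
    ring

theorem str_bracket (x y : Mat X m n) : str (matBracket x y) = 0 := by
  have h : ∀ i k : Idx X m n,
      sgn (par i) * sgn ((par i + par k) * (par k + par i)) = sgn (par k) := by
    intro i k
    rcases zmod_two_cases (par i) with hi | hi <;> rcases zmod_two_cases (par k) with hk | hk <;>
      simp [hi, hk, sgn]
    decide
  have : str (matBracket x y) = ∑ i, ∑ k, sgn (par i) * (x i k * y k i) -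
      ∑ i, ∑ k, sgn (par k) * (x k i * y i k) := by
    rw [str_apply, ← Finset.sum_sub_distrib]
    refine Finset.sum_congr rfl fun i _ => ?_
    rw [matBracket_apply, Finset.mul_sum, ← Finset.sum_sub_distrib]
    refine Finset.sum_congr rfl fun k _ => ?_
    rw [← h i k]
    ring
  rw [this, Finset.sum_comm, sub_self]

theorem str_negAdjoint (x : Mat X m n) : str (negAdjoint x) = -str x := by
  rw [str_apply, str_apply, ← Equiv.sum_comp (oppEquiv (X := X) (m := m) (n := n)),
    ← Finset.sum_neg_distrib]
  refine Finset.sum_congr rfl fun i _ => ?_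
  have e : sgn ((par i + par i) * par i) = 1 := by
    rcases zmod_two_cases (par i) with h | h <;> simp [h, sgn]
    decide
  simp only [oppEquiv, Equiv.coe_fn_mk, par_opp, negAdjoint_apply, opp_opp, e,
    formSign_mul_self]
  ring

/-- Conjugation by the permutation matrix of `flip`. -/
def flipConj : Mat X m n ≃ₗ[ℂ] Mat X m n := Matrix.reindexLinearEquiv ℂ ℂ flipEquiv flipEquiv

theorem flipConj_apply (x : Mat X m n) (i j : Idx X m n) :
    flipConj x i j = x (flip i) (flip j) := rfl

theorem flipConj_bracket (x y : Mat X m n) :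
    flipConj (matBracket x y) = matBracket (flipConj x) (flipConj y) := by
  ext i j
  rw [flipConj_apply, matBracket_apply, matBracket_apply,
    ← Equiv.sum_comp (flipEquiv (X := X) (m := m) (n := n))]
  simp [flipConj_apply, flipEquiv]

theorem negAdjoint_flipConj (x : Mat X m n) :
    negAdjoint (flipConj x) = flipConj (negAdjoint x) := by
  ext i j
  simp [negAdjoint_apply, flipConj_apply, opp_flip]

/-! ### The basic classical simple Lie superalgebra and its diagram automorphism -/

variable (X m n) in
/-- The orthosymplectic Lie superalgebra `osp(2m+2|2n)` in case `D(m+1,n)^(2)`, and the special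
linear Lie superalgebra in the other cases. -/
def linAlg : Submodule ℂ (Mat X m n) :=
  match X with
  | .DD => LinearMap.eqLocus negAdjoint LinearMap.id
  | _ => LinearMap.ker str

variable (X m n) in
/-- The automorphism of the matrix superalgebra that induces `σ`. -/
def matSigma : Mat X m n →ₗ[ℂ] Mat X m n :=
  match X with
  | .DD => flipConj.toLinearMap
  | _ => negAdjoint

theorem str_of_mem {x : Mat X m n} (hx : x ∈ linAlg X m n) : str x = 0 := by
  cases X <;> try exact hx
  have h : negAdjoint x = x := hx
  have h1 := str_negAdjoint x
  rw [h] at h1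
  linear_combination h1 / 2

theorem bracket_mem_linAlg {x y : Mat X m n} (hx : x ∈ linAlg X m n) (hy : y ∈ linAlg X m n) :
    matBracket x y ∈ linAlg X m n := by
  cases X <;> try exact str_bracket x y
  have h : negAdjoint x = x := hx
  have h' : negAdjoint y = y := hy
  change negAdjoint (matBracket x y) = matBracket x y
  rw [negAdjoint_bracket, h, h']

theorem matSigma_bracket (x y : Mat X m n) :
    matSigma X m n (matBracket x y) = matBracket (matSigma X m n x) (matSigma X m n y) := by
  cases X
  case DD => exact flipConj_bracket x y
  all_goals exact negAdjoint_bracket x y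

theorem matSigma_mem {x : Mat X m n} (hx : x ∈ linAlg X m n) :
    matSigma X m n x ∈ linAlg X m n := by
  cases X
  case DD =>
    have h : negAdjoint x = x := hx
    change negAdjoint (flipConj x) = flipConj x
    rw [negAdjoint_flipConj, h]
  all_goals
    have h : str x = 0 := hx
    change str (negAdjoint x) = 0
    rw [str_negAdjoint, h, neg_zero]

theorem matSigma_one : matSigma X m n 1 ∈ Submodule.span ℂ {(1 : Mat X m n)} := by
  rw [Submodule.mem_span_singleton]
  cases X
  case DD =>
    refine ⟨1, ?_⟩
    ext i j
    change _ = (1 : Mat _ _ _) (flip i) (flip j)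
    have : flip i = flip j ↔ i = j := (flipEquiv (X := .DD) (m := m) (n := n)).injective.eq_iff
    simp [Matrix.one_apply, this]
  all_goals
    refine ⟨-1, ?_⟩
    ext i j
    change _ = negAdjoint (1 : Mat _ _ _) i j
    rw [negAdjoint_apply]
    have : opp j = opp i ↔ i = j := by
      rw [eq_comm]
      exact oppEquiv.injective.eq_iff
    by_cases h : i = j
    · subst h
      have e : sgn ((par i + par i) * par i) = 1 := by
        rcases zmod_two_cases (par i) with h | h <;> simp [h, sgn]
        decide
      simp [e, formSign_mul_self]
    · simp [this, h]

theorem bracket_one (x : Mat X m n) : matBracket x 1 = 0 := by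
  ext i j
  have e : sgn 0 = 1 := by simp [sgn]
  have e1 : ∀ a : ZMod 2, a + a = 0 := by decide
  rw [matBracket_apply, Finset.sum_sub_distrib]
  simp [Matrix.one_apply, e1, e]

theorem one_bracket (x : Mat X m n) : matBracket 1 x = 0 := by
  ext i j
  have e : sgn 0 = 1 := by simp [sgn]
  have e1 : ∀ a : ZMod 2, a + a = 0 := by decide
  rw [matBracket_apply, Finset.sum_sub_distrib]
  simp [Matrix.one_apply, e1, e]

variable (X m n) in
/-- The scalar matrices in `linAlg X m n` (nonzero only for `sl(k|k)`). -/
def scalars : Submodule ℂ (linAlg X m n) :=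
  (Submodule.span ℂ {(1 : Mat X m n)}).comap (linAlg X m n).subtype

theorem exists_of_mem_scalars {z : linAlg X m n} (hz : z ∈ scalars X m n) :
    ∃ c : ℂ, (z : Mat X m n) = c • 1 := by
  obtain ⟨c, hc⟩ := Submodule.mem_span_singleton.1 (Submodule.mem_comap.1 hz)
  exact ⟨c, hc.symm⟩

variable (X m n) in
/-- The basic classical simple Lie superalgebra `𝒯` of type `A` or `D`. -/
abbrev FinAlg : Type := linAlg X m n ⧸ scalars X m n

def linBracket : linAlg X m n →ₗ[ℂ] linAlg X m n →ₗ[ℂ] linAlg X m n :=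
  LinearMap.mk₂ ℂ (fun x y => ⟨matBracket x.1 y.1, bracket_mem_linAlg x.2 y.2⟩)
    (by intro x x' y; ext1; simp) (by intro c x y; ext1; simp)
    (by intro x y y'; ext1; simp) (by intro c x y; ext1; simp)

/-- The bracket of `𝒯`. -/
def finBracket : FinAlg X m n →ₗ[ℂ] FinAlg X m n →ₗ[ℂ] FinAlg X m n :=
  (linBracket.compr₂ (scalars X m n).mkQ).liftQ₂ (scalars X m n) (scalars X m n)
    (by
      intro z hz
      obtain ⟨c, hc⟩ := exists_of_mem_scalars hz
      have h : linBracket z = 0 := by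
        ext y : 2
        simp [linBracket, hc, one_bracket]
      rw [LinearMap.mem_ker]
      ext y
      simp [h])
    (by
      intro z hz
      obtain ⟨c, hc⟩ := exists_of_mem_scalars hz
      have h : ∀ y, linBracket y z = 0 := by
        intro y
        ext1
        simp [linBracket, hc, bracket_one]
      rw [LinearMap.mem_ker]
      ext y
      simp [h])

theorem finBracket_mk (x y : linAlg X m n) :
    finBracket (Submodule.Quotient.mk x) (Submodule.Quotient.mk y) =
      Submodule.Quotient.mk (linBracket x y) := rfl

/-- The `ℤ/2`-grading of `𝒯`. -/
def finPart (a : ZMod 2) : Submodule ℂ (FinAlg X m n) :=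
  ((matPart a).comap (linAlg X m n).subtype).map (scalars X m n).mkQ

/-- The automorphism `σ` of `𝒯`. -/
def finSigma : FinAlg X m n →ₗ[ℂ] FinAlg X m n :=
  (scalars X m n).mapQ (scalars X m n) ((matSigma X m n).restrict fun _ hx => matSigma_mem hx)
    (by
      intro z hz
      obtain ⟨c, hc⟩ := exists_of_mem_scalars hz
      change matSigma X m n z.1 ∈ Submodule.span ℂ {(1 : Mat X m n)}
      rw [hc, map_smul]
      exact Submodule.smul_mem _ _ matSigma_one)

theorem finSigma_mk (x : linAlg X m n) :
    finSigma (Submodule.Quotient.mk x) =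
      Submodule.Quotient.mk (p := scalars X m n) ⟨matSigma X m n x.1, matSigma_mem x.2⟩ := rfl

theorem finSigma_bracket (x y : FinAlg X m n) :
    finSigma (finBracket x y) = finBracket (finSigma x) (finSigma y) := by
  obtain ⟨x, rfl⟩ := Submodule.Quotient.mk_surjective _ x
  obtain ⟨y, rfl⟩ := Submodule.Quotient.mk_surjective _ y
  rw [finBracket_mk, finSigma_mk, finSigma_mk, finSigma_mk, finBracket_mk]
  congr 1
  ext1
  exact matSigma_bracket x.1 y.1

/-- Half of the supertrace form on matrices. -/
def matForm : Mat X m n →ₗ[ℂ] Mat X m n →ₗ[ℂ] ℂ :=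
  LinearMap.mk₂ ℂ (fun x y => (1 / 2) * str (x * y))
    (by intro x x' y; simp [add_mul, mul_add])
    (by intro c x y; simp; ring)
    (by intro x y y'; simp [mul_add])
    (by intro c x y; simp; ring)

/-- The even nondegenerate supersymmetric invariant bilinear form on `𝒯`, normalized so that
the induced form on weights has `(ε_i, ε_j) = δ_{ij}` and `(δ_p, δ_q) = -δ_{pq}`. -/
def finForm : FinAlg X m n →ₗ[ℂ] FinAlg X m n →ₗ[ℂ] ℂ :=
  (matForm.domRestrict₁₂ (linAlg X m n) (linAlg X m n)).liftQ₂ (scalars X m n) (scalars X m n)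
    (by
      intro z hz
      obtain ⟨c, hc⟩ := exists_of_mem_scalars hz
      rw [LinearMap.mem_ker]
      ext y
      change (1 / 2) * str (z.1 * y.1) = 0
      simp [hc, str_of_mem y.2])
    (by
      intro z hz
      obtain ⟨c, hc⟩ := exists_of_mem_scalars hz
      rw [LinearMap.mem_ker]
      ext y
      change (1 / 2) * str (y.1 * z.1) = 0
      simp [hc, str_of_mem y.2])

theorem finForm_mk (x y : linAlg X m n) :
    finForm (Submodule.Quotient.mk x) (Submodule.Quotient.mk y) = (1 / 2) * str (x.1 * y.1) := rfl

variable (X m n) in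
/-- The standard Cartan subalgebra `H` of `𝒯`: the classes of the diagonal matrices. -/
def finCartan : Submodule ℂ (FinAlg X m n) :=
  Submodule.map (scalars X m n).mkQ
    { carrier := {x | (x : Mat X m n).IsDiag}
      add_mem' := fun hx hy => hx.add hy
      zero_mem' := Matrix.isDiag_zero
      smul_mem' := fun c _ hx => hx.smul c }

variable (X m n) in
/-- The fixed point subalgebra `𝔥` of `H` under `σ`. -/
def fixedCartan : Submodule ℂ (FinAlg X m n) :=
  finCartan X m n ⊓ LinearMap.eqLocus finSigma LinearMap.id

theorem exists_diag_of_mem_fixedCartan {x : FinAlg X m n} (hx : x ∈ fixedCartan X m n) :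
    ∃ y : linAlg X m n, Submodule.Quotient.mk y = x ∧ (y : Mat X m n).IsDiag ∧
      ∃ c : ℂ, matSigma X m n y = y + c • 1 := by
  obtain ⟨⟨y, hy, rfl⟩, h⟩ := hx
  refine ⟨y, rfl, hy, ?_⟩
  have h1 : finSigma (Submodule.Quotient.mk y) = Submodule.Quotient.mk y := h
  rw [finSigma_mk, Submodule.Quotient.eq] at h1
  obtain ⟨c, hc⟩ := exists_of_mem_scalars h1
  refine ⟨c, ?_⟩
  rw [← hc]
  simp

theorem opp_inj (i j : Idx X m n) : opp i = opp j ↔ i = j :=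
  (oppEquiv (X := X) (m := m) (n := n)).injective.eq_iff

theorem flip_inj (i j : Idx X m n) : flip i = flip j ↔ i = j :=
  (flipEquiv (X := X) (m := m) (n := n)).injective.eq_iff

/-- The diagonal matrix with entries `1` at `i` and `-1` at `opp i` (zero if `opp i = i`). -/
def corootMat (i : Idx X m n) : Mat X m n :=
  Matrix.diagonal fun k => (if k = i then 1 else 0) - (if k = opp i then 1 else 0)

theorem negAdjoint_diagonal (d : Idx X m n → ℂ) :
    negAdjoint (Matrix.diagonal d) = Matrix.diagonal fun k => -d (opp k) := by
  ext i j
  rw [negAdjoint_apply]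
  by_cases h : i = j
  · subst h
    have e : sgn ((par i + par i) * par i) = 1 := by
      rcases zmod_two_cases (par i) with h | h <;> simp [h, sgn]
      decide
    simp [e, formSign_mul_self]
  · have h' : ¬ j = i := fun e => h e.symm
    simp [opp_inj, h, h']

theorem negAdjoint_corootMat (i : Idx X m n) : negAdjoint (corootMat i) = corootMat i := by
  rw [corootMat, negAdjoint_diagonal]
  congr 1
  ext k
  have e : opp k = i ↔ k = opp i := by
    constructor <;> (rintro rfl; simp)
  simp [opp_inj, e]

theorem flipConj_corootMat (i : Idx X m n) (hi : flip i = i) :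
    flipConj (corootMat i) = corootMat i := by
  have h1 : ∀ k, flip k = i ↔ k = i := fun k => by conv_lhs => rw [← hi, flip_inj]
  have h2 : ∀ k, flip k = opp i ↔ k = opp i := fun k => by
    conv_lhs => rw [← hi, opp_flip, flip_inj]
  ext k l
  rw [flipConj_apply]
  simp [corootMat, Matrix.diagonal_apply, flip_inj, h1, h2]

theorem corootMat_mem (i : Idx X m n) : corootMat i ∈ linAlg X m n := by
  have h : str (corootMat i) = 0 := by
    have := str_negAdjoint (corootMat i)
    rw [negAdjoint_corootMat] at this
    linear_combination this / 2
  cases X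
  case DD => exact negAdjoint_corootMat i
  all_goals exact h

theorem flip_eq_self (hX : X ≠ .DD) (i : Idx X m n) : flip i = i := by
  have : Subsingleton (Fin X.extraEven) := by
    cases X <;> first | exact absurd rfl hX | (simp only [Family.extraEven]; infer_instance)
  rcases i with (i | i | i) | (i | i | i) <;> simp only [flip]
  rw [Subsingleton.elim i.rev i]

theorem coroot_mem (i : Idx X m n) (hi : flip i = i) :
    Submodule.Quotient.mk ⟨corootMat i, corootMat_mem i⟩ ∈ fixedCartan X m n := by
  refine ⟨⟨_, Matrix.isDiag_diagonal _, rfl⟩, ?_⟩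
  have h : matSigma X m n (corootMat i) = corootMat i := by
    cases X
    case DD => exact flipConj_corootMat i hi
    all_goals exact negAdjoint_corootMat i
  change finSigma (Submodule.Quotient.mk _) = Submodule.Quotient.mk _
  rw [finSigma_mk]
  congr 1
  ext1
  exact h

theorem eq_zero_of_finForm_eq_zero {x : FinAlg X m n} (hx : x ∈ fixedCartan X m n)
    (h : ∀ y ∈ fixedCartan X m n, finForm x y = 0) : x = 0 := by
  obtain ⟨y, rfl, hy, c, hc⟩ := exists_diag_of_mem_fixedCartan hx
  obtain ⟨d, hd⟩ : ∃ d : Idx X m n → ℂ, (y : Mat X m n) = Matrix.diagonal d :=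
    ⟨_, hy.diagonal_diag.symm⟩
  have key : ∀ i : Idx X m n, flip i = i → d i = d (opp i) := by
    intro i hi
    have h1 := h _ (coroot_mem i hi)
    rw [finForm_mk] at h1
    change 1 / 2 * str ((y : Mat X m n) * corootMat i) = 0 at h1
    rw [hd, corootMat, Matrix.diagonal_mul_diagonal, str_apply] at h1
    simp only [Matrix.diagonal_apply_eq, mul_sub, Finset.sum_sub_distrib] at h1
    simp at h1
    have h2 : sgn (par i) ≠ 0 := by unfold sgn; split_ifs <;> norm_num
    rw [sub_eq_zero] at h1
    exact mul_left_cancel₀ h2 (mul_left_cancel₀ (by norm_num) h1)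
  have hsc : ∃ b : ℂ, ∀ i, d i = b := by
    by_cases hX : X = .DD
    · subst hX
      have h1 : ∀ i, d (opp i) = -d i := by
        intro i
        have h0 : negAdjoint (y : Mat .DD m n) = y := y.2
        rw [hd, negAdjoint_diagonal] at h0
        have := congrFun (Matrix.diagonal_injective h0) i
        linear_combination -this
      have h2 : ∀ i, d (flip i) = d i + c := by
        intro i
        have h0 : flipConj (y : Mat .DD m n) = y + c • 1 := hc
        have := congrFun (congrFun h0 i) i
        rw [hd, flipConj_apply] at this
        simpa using this
      have hc0 : c = 0 := by
        have a := h2 (.inl (.inr (.inr (0 : Fin 2))))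
        have b := h2 (flip (.inl (.inr (.inr (0 : Fin 2)))))
        rw [flip_flip] at b
        linear_combination (-a - b) / 2
      refine ⟨0, fun i => ?_⟩
      have a : d i = d (opp i) := by
        by_cases hi : flip i = i
        · exact key i hi
        · rcases i with (i | i | i) | (i | i | i) <;> first | exact absurd rfl hi | skip
          have := h2 (.inl (.inr (.inr i)))
          rw [hc0, add_zero] at this
          exact this.symm
      have b := h1 i
      linear_combination (a + b) / 2
    · refine ⟨-c / 2, fun i => ?_⟩
      have h0 : negAdjoint (y : Mat X m n) = y + c • 1 := by
        rw [← hc]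
        cases X <;> first | exact absurd rfl hX | rfl
      rw [hd, negAdjoint_diagonal] at h0
      have := congrFun (congrFun h0 i) i
      simp at this
      have a := key i (flip_eq_self hX i)
      linear_combination (a - this) / 2
  obtain ⟨b, hb⟩ := hsc
  rw [Submodule.Quotient.mk_eq_zero]
  refine Submodule.mem_comap.2 (Submodule.mem_span_singleton.2 ⟨b, ?_⟩)
  change _ = (y : Mat X m n)
  rw [hd, funext hb]
  ext i j
  by_cases e : i = j <;> simp [e]

theorem finForm_comm {x y : FinAlg X m n} (hx : x ∈ fixedCartan X m n)
    (hy : y ∈ fixedCartan X m n) : finForm x y = finForm y x := by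
  obtain ⟨x, rfl, h, -⟩ := exists_diag_of_mem_fixedCartan hx
  obtain ⟨y, rfl, h', -⟩ := exists_diag_of_mem_fixedCartan hy
  rw [finForm_mk, finForm_mk, ← h.diagonal_diag, ← h'.diagonal_diag,
    Matrix.diagonal_mul_diagonal, Matrix.diagonal_mul_diagonal]
  simp only [mul_comm]

/-! ### The twisted affine Lie superalgebra -/

variable (X m n) in
/-- `(𝒯 ⊗ ℂ[t, t⁻¹]) ⊕ ℂ c ⊕ ℂ d`; the triple `(f, r, s)` stands for
`∑ k, f k ⊗ t ^ k + r c + s d`. -/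
abbrev LoopExt : Type := (ℤ →₀ FinAlg X m n) × ℂ × ℂ

variable (X m n) in
/-- The twisted affine Lie superalgebra `ℒ`: the coefficient of `t ^ k` lies in the eigenspace
of `σ` for the eigenvalue `ζ ^ k`. -/
def affine : Submodule ℂ (LoopExt X m n) where
  carrier := {x | ∀ k, finSigma (x.1 k) = X.rootOfUnity ^ k • x.1 k}
  add_mem' := by
    intro x y hx hy k
    simp [hx k, hy k]
  zero_mem' := by intro k; simp
  smul_mem' := by
    intro c x hx k
    simp [hx k, smul_comm c]

variable (X m n) in
abbrev Aff : Type := affine X m n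

/-- The bracket of `𝒯 ⊗ ℂ[t, t⁻¹]`. -/
def loopBracket (f g : ℤ →₀ FinAlg X m n) : ℤ →₀ FinAlg X m n :=
  f.sum fun p x => g.sum fun q y => Finsupp.single (p + q) (finBracket x y)

/-- The derivation `t d/dt` of `𝒯 ⊗ ℂ[t, t⁻¹]`. -/
def loopDeriv (f : ℤ →₀ FinAlg X m n) : ℤ →₀ FinAlg X m n :=
  f.sum fun p x => Finsupp.single p ((p : ℂ) • x)

/-- The 2-cocycle `(x ⊗ t ^ p, y ⊗ t ^ q) ↦ p (x, y) δ_{p+q,0}`. -/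
def loopCocycle (f g : ℤ →₀ FinAlg X m n) : ℂ :=
  f.sum fun p x => (p : ℂ) * finForm x (g (-p))

theorem single_mem_affine {k : ℤ} {x : FinAlg X m n}
    (hx : finSigma x = X.rootOfUnity ^ k • x) (r s : ℂ) :
    (Finsupp.single k x, r, s) ∈ affine X m n := by
  intro j
  by_cases h : k = j
  · subst h; simpa using hx
  · simp [h]

theorem sum_mem_affine {ι : Type} {S : Finset ι} {F : ι → ℤ →₀ FinAlg X m n}
    (h : ∀ i ∈ S, (F i, (0 : ℂ), (0 : ℂ)) ∈ affine X m n) (r s : ℂ) :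
    (∑ i ∈ S, F i, r, s) ∈ affine X m n := by
  intro k
  change finSigma ((∑ i ∈ S, F i) k) = _ • (∑ i ∈ S, F i) k
  rw [Finsupp.finsetSum_apply, map_sum, Finset.smul_sum]
  exact Finset.sum_congr rfl fun i hi => h i hi k

theorem loopBracket_mem {x y : LoopExt X m n} (hx : x ∈ affine X m n) (hy : y ∈ affine X m n) :
    (loopBracket x.1 y.1, (0 : ℂ), (0 : ℂ)) ∈ affine X m n := by
  refine sum_mem_affine (fun p _ => sum_mem_affine (fun q _ => ?_) 0 0) 0 0
  refine single_mem_affine ?_ 0 0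
  rw [finSigma_bracket, hx p, hy q, zpow_add₀ X.rootOfUnity_ne_zero]
  simp [smul_smul, mul_comm]

theorem loopDeriv_mem {x : LoopExt X m n} (hx : x ∈ affine X m n) :
    (loopDeriv x.1, (0 : ℂ), (0 : ℂ)) ∈ affine X m n := by
  refine sum_mem_affine (fun p _ => single_mem_affine ?_ 0 0) 0 0
  rw [map_smul, hx p, smul_comm]

/-- The bracket of `ℒ`. -/
def affBracket (x y : Aff X m n) : Aff X m n :=
  ⟨(loopBracket x.1.1 y.1.1 + x.1.2.2 • loopDeriv y.1.1 - y.1.2.2 • loopDeriv x.1.1,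
      loopCocycle x.1.1 y.1.1, 0), by
    intro k
    have h1 := loopBracket_mem x.2 y.2 k
    have h2 := loopDeriv_mem x.2 k
    have h3 := loopDeriv_mem y.2 k
    simp only at h1 h2 h3
    simp only [Finsupp.add_apply, Finsupp.sub_apply, Finsupp.smul_apply, map_add, map_sub,
      map_smul, h1, h2, h3, smul_add, smul_sub, smul_comm _ (X.rootOfUnity ^ k)]⟩

/-- The `ℤ/2`-grading of `ℒ`. -/
def affPart (a : ZMod 2) : Submodule ℂ (Aff X m n) where
  carrier := {x | (∀ k, x.1.1 k ∈ finPart a) ∧ (a ≠ 0 → x.1.2 = 0)}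
  add_mem' := by
    rintro x y ⟨hx, hx'⟩ ⟨hy, hy'⟩
    exact ⟨fun k => add_mem (hx k) (hy k), fun h => by simp [hx' h, hy' h]⟩
  zero_mem' := ⟨fun _ => zero_mem _, fun _ => rfl⟩
  smul_mem' := by
    rintro c x ⟨hx, hx'⟩
    exact ⟨fun k => Submodule.smul_mem _ c (hx k), fun h => by simp [hx' h]⟩

/-- The canonical central element `c`. -/
def central : Aff X m n := ⟨(0, 1, 0), by intro k; simp⟩

/-! ### The Cartan subalgebra, roots and the form on weights -/

variable (X m n) in
/-- The standard Cartan subalgebra `ℋ = 𝔥 ⊕ ℂ c ⊕ ℂ d` of `ℒ`. -/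
abbrev Cartan : Type := fixedCartan X m n × ℂ × ℂ

/-- The inclusion of `ℋ` into `ℒ`. -/
def cartanIncl : Cartan X m n →ₗ[ℂ] Aff X m n where
  toFun h := ⟨(Finsupp.single 0 (h.1 : FinAlg X m n), h.2.1, h.2.2),
    single_mem_affine (by simpa using h.1.2.2) _ _⟩
  map_add' h h' := by
    ext1
    exact Prod.ext (by simp) rfl
  map_smul' c h := by
    ext1
    exact Prod.ext (by simp) rfl

/-- The restriction to `ℋ` of the invariant form of `ℒ`:
`(x + r c + s d, y + r' c + s' d) = (x, y) + r s' + s r'`. -/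
def cartanForm : LinearMap.BilinForm ℂ (Cartan X m n) :=
  LinearMap.mk₂ ℂ (fun h h' => finForm (h.1 : FinAlg X m n) (h'.1 : FinAlg X m n) +
      h.2.1 * h'.2.2 + h.2.2 * h'.2.1)
    (by intro x x' y; simp; ring) (by intro c x y; simp; ring)
    (by intro x y y'; simp; ring) (by intro c x y; simp; ring)

theorem cartanForm_apply (h h' : Cartan X m n) :
    cartanForm h h' = finForm (h.1 : FinAlg X m n) (h'.1 : FinAlg X m n) +
      h.2.1 * h'.2.2 + h.2.2 * h'.2.1 := rfl

theorem cartanForm_comm (h h' : Cartan X m n) : cartanForm h h' = cartanForm h' h := by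
  rw [cartanForm_apply, cartanForm_apply, finForm_comm h.1.2 h'.1.2]
  ring

theorem eq_zero_of_cartanForm (h : Cartan X m n) (hh : ∀ h', cartanForm h h' = 0) : h = 0 := by
  obtain ⟨x, r, s⟩ := h
  have h1 : s = 0 := by simpa [cartanForm_apply] using hh (0, 1, 0)
  have h2 : r = 0 := by simpa [cartanForm_apply] using hh (0, 0, 1)
  have h3 : (x : FinAlg X m n) = 0 :=
    eq_zero_of_finForm_eq_zero x.2 fun y hy => by
      simpa [cartanForm_apply] using hh (⟨y, hy⟩, 0, 0)
  have h4 : x = 0 := Subtype.ext h3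
  rw [h1, h2, h4]
  rfl

theorem cartanForm_nondegenerate : (cartanForm (X := X) (m := m) (n := n)).Nondegenerate :=
  ⟨eq_zero_of_cartanForm,
    fun h hh => eq_zero_of_cartanForm h fun h' => by rw [cartanForm_comm, hh]⟩

variable (X m n) in
/-- The dual space `ℋ^*`. -/
abbrev Weight : Type := Module.Dual ℂ (Cartan X m n)

/-- The element `t_α` of `ℋ` with `α h = (t_α, h)` for all `h`. -/
def weightVec (α : Weight X m n) : Cartan X m n :=
  (cartanForm.toDual cartanForm_nondegenerate).symm α

/-- The induced symmetric bilinear form on `ℋ^*`. -/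
def weightForm (α β : Weight X m n) : ℂ := cartanForm (weightVec α) (weightVec β)

/-- The weight `δ`, given by `δ(d) = 1` and `δ(𝔥 ⊕ ℂ c) = 0`. -/
def delta : Weight X m n := LinearMap.snd ℂ ℂ ℂ ∘ₗ LinearMap.snd ℂ (fixedCartan X m n) (ℂ × ℂ)

/-- The root space `ℒ^α`. -/
def rootSpace (α : Weight X m n) : Set (Aff X m n) :=
  {x | ∀ h : Cartan X m n, affBracket (cartanIncl h) x = α h • x}

variable (X m n) in
/-- The root system `R` of `ℒ` (including `0`). -/
def roots : Set (Weight X m n) := {α | ∃ x ∈ rootSpace α, x ≠ 0}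

variable (X m n) in
/-- The real roots. -/
def realRoots : Set (Weight X m n) := {α | α ∈ roots X m n ∧ weightForm α α ≠ 0}

variable (X m n) in
/-- The finite set `Ṙ` of the weights `α` in `𝔥^*` with `(α + ℤ δ) ∩ R ≠ ∅`, where `𝔥^*` is
identified with the space of weights that vanish at `c` and `d`. -/
def dotRoots : Set (Weight X m n) :=
  {α | (∀ r s : ℂ, α (0, r, s) = 0) ∧ ∃ k : ℤ, α + k • delta ∈ roots X m n}

variable (X m n) in
/-- The set `Ṙ_re`. -/
def dotRealRoots : Set (Weight X m n) :=
  {α | α ∈ dotRoots X m n ∧ weightForm α α ≠ 0}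

/-! ### Modules -/

variable (X m n) in
/-- The structure of an `ℒ`-module on a complex superspace `V = V_0 ⊕ V_1`. -/
structure AffModule (V : Type*) [AddCommGroup V] [Module ℂ V] where
  part : ZMod 2 → Submodule ℂ V
  isCompl : IsCompl (part 0) (part 1)
  act : Aff X m n →ₗ[ℂ] Module.End ℂ V
  act_mem : ∀ (a b : ZMod 2), ∀ x ∈ affPart a, ∀ v ∈ part b, act x v ∈ part (a + b)
  act_bracket : ∀ (a b : ZMod 2), ∀ x ∈ affPart a, ∀ y ∈ affPart b, ∀ v,
    act (affBracket x y) v = act x (act y v) - sgn (a * b) • act y (act x v)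

namespace AffModule

variable {V : Type*} [AddCommGroup V] [Module ℂ V] (M : AffModule X m n V)

/-- The weight space `V^lam`. -/
def weightSpace (lam : Weight X m n) : Submodule ℂ V where
  carrier := {v | ∀ h : Cartan X m n, M.act (cartanIncl h) v = lam h • v}
  add_mem' := by
    intro v w hv hw h
    simp [hv h, hw h]
  zero_mem' := by intro h; simp
  smul_mem' := by
    intro c v hv h
    simp [hv h, smul_comm c]

/-- The support of `V`. -/
def supp : Set (Weight X m n) := {lam | M.weightSpace lam ≠ ⊥}

/-- `V` is the direct sum of its weight spaces, which are all finite dimensional. -/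
def IsFiniteWeight : Prop :=
  (iSupIndep M.weightSpace ∧ ⨆ lam, M.weightSpace lam = ⊤) ∧
    ∀ lam, FiniteDimensional ℂ (M.weightSpace lam)

/-- `V` is nonzero, and its only (graded) submodules are `0` and `V`. -/
def IsSimple : Prop :=
  Nontrivial V ∧ ∀ W : Submodule ℂ V, (W ⊓ M.part 0) ⊔ (W ⊓ M.part 1) = W →
    (∀ x, ∀ v ∈ W, M.act x v ∈ W) → W = ⊥ ∨ W = ⊤

/-- The canonical central element acts as zero. -/
def IsZeroLevel : Prop := M.act central = 0

/-- `R^ln(V)`: the real roots whose nonzero root vectors act locally nilpotently. -/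
def lnRoots : Set (Weight X m n) :=
  {α | α ∈ realRoots X m n ∧ ∀ x ∈ rootSpace α, x ≠ 0 → ∀ v, ∃ N : ℕ, (M.act x ^ N) v = 0}

/-- `R^in(V)`: the real roots whose nonzero root vectors act injectively. -/
def inRoots : Set (Weight X m n) :=
  {α | α ∈ realRoots X m n ∧ ∀ x ∈ rootSpace α, x ≠ 0 → Function.Injective (M.act x)}

/-- `β ∈ Ṙ_re` is full-locally nilpotent: `(β + ℤ δ) ∩ R ⊆ R^ln(V)`. -/
def FullLocallyNilpotent (β : Weight X m n) : Prop :=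
  β ∈ dotRealRoots X m n ∧ ∀ k : ℤ, β + k • delta ∈ roots X m n → β + k • delta ∈ M.lnRoots

/-- `β ∈ Ṙ_re` is down-nilpotent hybrid. -/
def DownNilpotentHybrid (β : Weight X m n) : Prop :=
  β ∈ dotRealRoots X m n ∧ ∃ r t : ℤ, (t = 0 ∨ t = 1 ∨ t = -1) ∧
    ∀ k : ℤ,
      (β + r • delta + k • delta ∈ roots X m n →
        (1 ≤ k → β + r • delta + k • delta ∈ M.inRoots) ∧
        (k ≤ 0 → β + r • delta + k • delta ∈ M.lnRoots)) ∧
      (-(β + r • delta) + k • delta ∈ roots X m n →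
        (t ≤ k → -(β + r • delta) + k • delta ∈ M.inRoots) ∧
        (k ≤ t - 1 → -(β + r • delta) + k • delta ∈ M.lnRoots))

/-- `β ∈ Ṙ_re` is up-nilpotent hybrid. -/
def UpNilpotentHybrid (β : Weight X m n) : Prop :=
  β ∈ dotRealRoots X m n ∧ ∃ r t : ℤ, (t = 0 ∨ t = 1 ∨ t = -1) ∧
    ∀ k : ℤ,
      (β + r • delta + k • delta ∈ roots X m n →
        (k ≤ -1 → β + r • delta + k • delta ∈ M.inRoots) ∧
        (0 ≤ k → β + r • delta + k • delta ∈ M.lnRoots)) ∧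
      (-(β + r • delta) + k • delta ∈ roots X m n →
        (k ≤ -t → -(β + r • delta) + k • delta ∈ M.inRoots) ∧
        (1 - t ≤ k → -(β + r • delta) + k • delta ∈ M.lnRoots))

/-- `β ∈ Ṙ_re` is hybrid. -/
def Hybrid (β : Weight X m n) : Prop := M.DownNilpotentHybrid β ∨ M.UpNilpotentHybrid β

end AffModule

end TwistedAffine

end

noncomputable section

namespace TwistedAffine

variable {X : Family} {m n : ℕ}

/-! ### Matrices that are eigenvectors of the Cartan subalgebra -/

/-! The proof removes the direction `β` from the ray of weights, and then contradicts the local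
nilpotency along `α`. In this outline `α` and `β` stand for the real roots `ϱ • α` and `ϱ • β` of
the final statement, and weights matter only modulo `ℤδ`.

For a real root `α`, `exists_slTwo` supplies operators `E j`, `F j` that satisfy the `sl₂` relations
on weight spaces and shift weights by `±(cα + (q + pj)δ)`. Here `c = 1` if the chosen root vectors
are even. If they are odd, their squares are used and `c = 2`. At level zero the coroot acts on a
weight `λ` by `(2/c)(λ, α)/(α, α)`, independently of `j` and of the `δ`-component of `λ`.

The `sl₂` input is `raise_pow_lower_pow_ne_zero`: if `E` is nilpotent on `v` and the coroot value of
`v` has real part at least `s`, then `E ^ s F ^ s v ≠ 0`. In particular, one can go down `s` steps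
in the support. No integrality of weights is needed.

Removing `β` (`HasUnboundedRay.of_add`): if `β` is hybrid, some root vector of weight `-β + kδ` is
injective and can be applied as often as needed. If `β` is full-locally nilpotent, the coroot values
of `β` grow linearly along the ray, with no contribution from `α` by orthogonality, and the
criterion allows enough steps down.

Contradiction along `α` (`not_hasUnboundedRay`): starting far out on the ray, one application of a
suitable `F j` fixes the `δ`-coefficient up to finitely many values. Then `l` applications of `F 0`
lead to one of the weights `mu + iδ`, `0 ≤ i < p`, and `E 0 ^ l` does not kill the vector reached.
These finitely many weight spaces are finite dimensional and `E 0` is locally nilpotent, so a fixed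
power of `E 0` kills all of them; `l` large is impossible.

The existence of the `sl₂` operators rests on a signed conjugate transpose, which sends a root
vector `x` to one of opposite weight that pairs with `x` to a positive number. -/

theorem matBracket_diagonal (d : Idx X m n → ℂ) (x : Mat X m n) (i j : Idx X m n) :
    matBracket (Matrix.diagonal d) x i j = (d i - d j) * x i j := by
  have e : sgn 0 = 1 := by simp [sgn]
  have e1 : ∀ a : ZMod 2, a + a = 0 := by decide
  rw [matBracket_apply, Finset.sum_sub_distrib]
  simp [Matrix.diagonal_apply, e1, e]
  ring

/-- The matrix `x` is a weight vector for the adjoint action of `𝔥`, of weight `φ`. -/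
def HasMatWeight (φ : fixedCartan X m n → ℂ) (x : Mat X m n) : Prop :=
  ∀ (h : fixedCartan X m n) (d : Idx X m n → ℂ) (hd : Matrix.diagonal d ∈ linAlg X m n),
    (h : FinAlg X m n) = Submodule.Quotient.mk ⟨Matrix.diagonal d, hd⟩ →
    ∀ i j, (d i - d j) * x i j = φ h * x i j

theorem exists_diagonal_eq (h : fixedCartan X m n) :
    ∃ (d : Idx X m n → ℂ) (hd : Matrix.diagonal d ∈ linAlg X m n),
      (h : FinAlg X m n) = Submodule.Quotient.mk ⟨Matrix.diagonal d, hd⟩ := by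
  obtain ⟨y, hy, hd, -⟩ := exists_diag_of_mem_fixedCartan h.2
  obtain ⟨y, hyl⟩ := y
  obtain ⟨d, rfl⟩ : ∃ d : Idx X m n → ℂ, y = Matrix.diagonal d := ⟨_, hd.diagonal_diag.symm⟩
  exact ⟨d, hyl, hy.symm⟩

theorem HasMatWeight.finBracket_mk {φ : fixedCartan X m n → ℂ} {x : Mat X m n}
    (hx : HasMatWeight φ x) (hxl : x ∈ linAlg X m n) (h : fixedCartan X m n) :
    finBracket (h : FinAlg X m n) (Submodule.Quotient.mk ⟨x, hxl⟩) =
      φ h • (Submodule.Quotient.mk ⟨x, hxl⟩ : FinAlg X m n) := by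
  obtain ⟨d, hd, e⟩ := exists_diagonal_eq h
  rw [e, TwistedAffine.finBracket_mk, ← Submodule.Quotient.mk_smul]
  congr 1
  ext i j
  change matBracket (Matrix.diagonal d) x i j = φ h * x i j
  rw [matBracket_diagonal, hx h d hd e]

/-- The homogeneous component of degree `a`. -/
def homComponent (a : ZMod 2) : Mat X m n →ₗ[ℂ] Mat X m n where
  toFun x := Matrix.of fun i j => if par i + par j = a then x i j else 0
  map_add' x y := by ext i j; simp only [Matrix.of_apply, Matrix.add_apply]; split_ifs <;> simp
  map_smul' c x := by ext i j; simp

theorem homComponent_apply (a : ZMod 2) (x : Mat X m n) (i j : Idx X m n) :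
    homComponent a x i j = if par i + par j = a then x i j else 0 := rfl

theorem homComponent_mem (a : ZMod 2) (x : Mat X m n) : homComponent a x ∈ matPart a :=
  fun _ _ h => if_neg h

theorem matSigma_homComponent (a : ZMod 2) (x : Mat X m n) :
    matSigma X m n (homComponent a x) = homComponent a (matSigma X m n x) := by
  cases X
  case DD =>
    ext i j
    change homComponent a x (flip i) (flip j) = if _ then x (flip i) (flip j) else 0
    simp [homComponent_apply]
  all_goals
    ext i j
    change negAdjoint (homComponent a x) i j = if _ then negAdjoint x i j else 0
    rw [negAdjoint_apply, negAdjoint_apply, homComponent_apply]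
    simp only [par_opp, add_comm (par j)]
    split_ifs <;> simp

theorem mem_linAlg_of_diag_eq_zero {x : Mat X m n} (h : ∀ i, x i i = 0)
    (hDD : X = .DD → negAdjoint x = x) : x ∈ linAlg X m n := by
  cases X
  case DD => exact hDD rfl
  all_goals
    change str x = 0
    simp [str_apply, h]

theorem negAdjoint_eq_of_mem (hX : X = .DD) {x : Mat X m n} (hx : x ∈ linAlg X m n) :
    negAdjoint x = x := by
  subst hX; exact hx

theorem negAdjoint_homComponent (a : ZMod 2) (x : Mat X m n) :
    negAdjoint (homComponent a x) = homComponent a (negAdjoint x) := by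
  ext i j
  rw [negAdjoint_apply, homComponent_apply, homComponent_apply, negAdjoint_apply]
  simp only [par_opp, add_comm (par j)]
  split_ifs <;> simp

theorem matSigma_diag_eq_zero {x : Mat X m n} (h : ∀ i, x i i = 0) (i : Idx X m n) :
    matSigma X m n x i i = 0 := by
  cases X
  case DD => exact h _
  all_goals
    change negAdjoint x i i = 0
    rw [negAdjoint_apply, h]
    simp

/-! ### Signed conjugate transpose and positivity -/

/-- The conjugate transpose with the sign that makes `str (x * dagger x)` positive. -/
def dagger (x : Mat X m n) : Mat X m n :=
  Matrix.of fun i j => sgn (par j) * (starRingEnd ℂ) (x j i)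

theorem dagger_apply (x : Mat X m n) (i j : Idx X m n) :
    dagger x i j = sgn (par j) * (starRingEnd ℂ) (x j i) := rfl

theorem conj_sgn (a : ZMod 2) : (starRingEnd ℂ) (sgn a) = sgn a := by
  unfold sgn; split_ifs <;> simp

theorem conj_formSign (i : Idx X m n) : (starRingEnd ℂ) (formSign i) = formSign i := by
  rcases formSign_cases i with h | h <;> simp [h]

theorem negAdjoint_dagger (x : Mat X m n) : negAdjoint (dagger x) = dagger (negAdjoint x) := by
  ext i j
  simp only [negAdjoint_apply, dagger_apply, map_neg, map_mul, conj_sgn, conj_formSign, par_opp]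
  have e1 : (1 + 1 : ZMod 2) = 0 := by decide
  have e2 : sgn 0 = 1 := by simp [sgn]
  have e3 : sgn 1 = -1 := by simp [sgn]
  rcases zmod_two_cases (par i) with hi | hi <;> rcases zmod_two_cases (par j) with hj | hj <;>
    simp only [hi, hj, e1, e2, e3, add_zero, zero_add, mul_zero, mul_one] <;> ring

theorem matSigma_dagger (x : Mat X m n) :
    matSigma X m n (dagger x) = dagger (matSigma X m n x) := by
  cases X
  case DD =>
    ext i j
    change dagger x (flip i) (flip j) = sgn (par j) * (starRingEnd ℂ) (x (flip j) (flip i))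
    rw [dagger_apply, par_flip]
  all_goals exact negAdjoint_dagger x

/-- Since `ζ` lies on the unit circle, `dagger` carries the `ζ ^ k`-eigenspace of `σ` to the `ζ ^
(-k)`-eigenspace. -/
theorem Family.conj_rootOfUnity (X : Family) :
    (starRingEnd ℂ) X.rootOfUnity = X.rootOfUnity⁻¹ := by
  cases X <;> simp [Family.rootOfUnity]

/-- The period 4 serves all families at once, although `ζ` has order 2 in three of them. -/
theorem Family.rootOfUnity_pow_four (X : Family) : X.rootOfUnity ^ (4 : ℤ) = 1 := by
  have h : X.rootOfUnity ^ 4 = 1 := by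
    cases X <;> simp [Family.rootOfUnity]
    all_goals norm_num
  exact_mod_cast h

theorem Family.rootOfUnity_zpow_add (X : Family) (k j : ℤ) :
    X.rootOfUnity ^ (k + 4 * j) = X.rootOfUnity ^ k := by
  rw [zpow_add₀ X.rootOfUnity_ne_zero, zpow_mul, X.rootOfUnity_pow_four, one_zpow, mul_one]

theorem dagger_smul (c : ℂ) (x : Mat X m n) :
    dagger (c • x) = (starRingEnd ℂ) c • dagger x := by
  ext i j
  simp only [dagger_apply, Matrix.smul_apply, smul_eq_mul, map_mul]
  ring

theorem dagger_mem_matPart {a : ZMod 2} {x : Mat X m n} (hx : x ∈ matPart a) :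
    dagger x ∈ matPart a := by
  intro i j h
  rw [dagger_apply, hx j i (by rwa [add_comm]), map_zero, mul_zero]

/-- No conjugate of `φ` appears: wherever `x j i ≠ 0`, `φ h` is the difference `d j - d i`, and
transposition reverses its sign. -/
theorem HasMatWeight.dagger {φ : fixedCartan X m n → ℂ} {x : Mat X m n}
    (hx : HasMatWeight φ x) : HasMatWeight (fun h => -φ h) (dagger x) := by
  intro h d hd e i j
  rw [dagger_apply]
  by_cases h0 : x j i = 0
  · simp [h0]
  · have := mul_right_cancel₀ h0 (hx h d hd e j i)
    change _ = -φ h * _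
    rw [← this]
    ring

/-- The sign in `dagger` cancels the sign in the supertrace, which leaves the sum of the squared
absolute values of the entries. -/
theorem str_mul_dagger_ne_zero {x : Mat X m n} (hx : x ≠ 0) : str (x * dagger x) ≠ 0 := by
  have h : str (x * dagger x) = ((∑ i, ∑ k, ‖x i k‖ ^ 2 : ℝ) : ℂ) := by
    rw [str_apply]
    push_cast
    refine Finset.sum_congr rfl fun i _ => ?_
    rw [Matrix.mul_apply, Finset.mul_sum]
    refine Finset.sum_congr rfl fun k _ => ?_
    rw [dagger_apply, ← Complex.mul_conj']
    linear_combination (x i k * (starRingEnd ℂ) (x i k)) * sgn_mul_self (par i)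
  rw [h]
  intro h0
  apply hx
  have h1 : ∑ i, ∑ k, ‖x i k‖ ^ 2 = 0 := by exact_mod_cast h0
  ext i k
  have h2 := (Finset.sum_eq_zero_iff_of_nonneg
    (fun i _ => Finset.sum_nonneg fun k _ => by positivity)).1 h1 i (Finset.mem_univ _)
  have h3 := (Finset.sum_eq_zero_iff_of_nonneg (fun k _ => by positivity)).1 h2 k
    (Finset.mem_univ _)
  simpa using h3

/-! ### The bracket of a weight vector with a weight vector of opposite weight -/

/-- The coroot matrix of `i` has entry `1` at `i` and `0` or `-1` at every other index, so it
separates `i` from every `j ≠ i`. -/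
theorem HasMatWeight.offDiag_eq_zero {i : Idx X m n} (h : opp i ≠ i) (hf : flip i = i)
    {M : Mat X m n} (hM : HasMatWeight (fun _ => 0) M) {j : Idx X m n} (hij : i ≠ j) :
    M i j = 0 ∧ M j i = 0 := by
  have h1 := hM ⟨_, coroot_mem i hf⟩ _ (corootMat_mem i) rfl
  have h2 := h1 i j
  have h3 := h1 j i
  have h' : i ≠ opp i := h.symm
  simp only [if_true, zero_mul, mul_eq_zero, if_neg h', if_neg hij.symm] at h2 h3
  constructor
  · refine h2.resolve_left ?_
    split_ifs <;> norm_num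
  · refine h3.resolve_left ?_
    split_ifs <;> norm_num

/-- The coroots separate all basis vectors except the extra ones, which have weight zero. An extra
even and an extra odd vector are kept apart by parity, so only the two extra even vectors of `DD`
need an argument. -/
theorem isDiag_of_hasMatWeight_zero {M : Mat X m n} (hM : HasMatWeight (fun _ => 0) M)
    (hMl : M ∈ linAlg X m n) (hp : M ∈ matPart 0) : M.IsDiag := by
  have e1 : ∀ a b : ZMod 2, a ≠ b → a + b ≠ 0 := by decide
  intro i j hij
  by_cases hpar : par i = par j
  swap
  · exact hp i j (e1 _ _ hpar)
  rcases i with (i | i | i) | (i | i | i)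
  case inl.inl => exact (HasMatWeight.offDiag_eq_zero (by simp [opp]) rfl hM hij).1
  case inl.inr.inl => exact (HasMatWeight.offDiag_eq_zero (by simp [opp]) rfl hM hij).1
  case inr.inl => exact (HasMatWeight.offDiag_eq_zero (by simp [opp]) rfl hM hij).1
  case inr.inr.inl => exact (HasMatWeight.offDiag_eq_zero (by simp [opp]) rfl hM hij).1
  case inl.inr.inr =>
    rcases j with (j | j | j) | (j | j | j)
    case inl.inl => exact (HasMatWeight.offDiag_eq_zero (by simp [opp]) rfl hM hij.symm).2
    case inl.inr.inl => exact (HasMatWeight.offDiag_eq_zero (by simp [opp]) rfl hM hij.symm).2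
    case inl.inr.inr =>
      have hij' : i ≠ j := fun e => hij (by rw [e])
      -- In `DD`, `opp` interchanges the two extra vectors, and the orthosymplectic condition at
      -- this entry reads `M i j = -M i j`.
      by_cases hX : X = .DD
      · have h := congrFun (congrFun (negAdjoint_eq_of_mem hX hMl) (.inl (.inr (.inr i))))
          (.inl (.inr (.inr j)))
        subst hX
        have hr : ∀ i j : Fin Family.DD.extraEven, i ≠ j → i.rev = j ∧ j.rev = i :=
          (by decide : ∀ i j : Fin 2, i ≠ j → i.rev = j ∧ j.rev = i)
        obtain ⟨h1, h2⟩ := hr i j hij'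
        rw [negAdjoint_apply] at h
        simp only [opp, formSign, par, sgn, add_zero, mul_zero, if_true, one_mul] at h
        simp only [h1, h2] at h
        linear_combination -h / 2
      · exfalso
        apply hij'
        have : Subsingleton (Fin X.extraEven) := by
          cases X <;> first
            | exact absurd rfl hX
            | (simp only [Family.extraEven]; infer_instance)
        exact Subsingleton.elim _ _
    all_goals exact absurd hpar (by simp [par])
  case inr.inr.inr =>
    rcases j with (j | j | j) | (j | j | j)
    case inr.inl => exact (HasMatWeight.offDiag_eq_zero (by simp [opp]) rfl hM hij.symm).2
    case inr.inr.inl => exact (HasMatWeight.offDiag_eq_zero (by simp [opp]) rfl hM hij.symm).2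
    case inr.inr.inr =>
      exfalso
      apply hij
      have : Subsingleton (Fin X.extraOdd) := by
        cases X <;> simp only [Family.extraOdd] <;> infer_instance
      rw [Subsingleton.elim i j]
    all_goals exact absurd hpar (by simp [par])

theorem matBracket_mem_matPart {a b : ZMod 2} {x y : Mat X m n} (hx : x ∈ matPart a)
    (hy : y ∈ matPart b) : matBracket x y ∈ matPart (a + b) := by
  intro i j h
  have e2 : ∀ a b p q r : ZMod 2, p + r ≠ a + b →
      (p + q ≠ a ∨ q + r ≠ b) ∧ (p + q ≠ b ∨ q + r ≠ a) := by decide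
  rw [matBracket_apply]
  refine Finset.sum_eq_zero fun k _ => ?_
  obtain ⟨h1, h2⟩ := e2 a b (par i) (par k) (par j) h
  have h3 : x i k * y k j = 0 := by
    rcases h1 with h1 | h1
    · rw [hx _ _ h1, zero_mul]
    · rw [hy _ _ h1, mul_zero]
  have h4 : y i k * x k j = 0 := by
    rcases h2 with h2 | h2
    · rw [hy _ _ h2, zero_mul]
    · rw [hx _ _ h2, mul_zero]
  rw [h3, h4]
  simp

theorem HasMatWeight.matBracket {φ ψ : fixedCartan X m n → ℂ} {x y : Mat X m n}
    (hx : HasMatWeight φ x) (hy : HasMatWeight ψ y) :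
    HasMatWeight (fun h => φ h + ψ h) (matBracket x y) := by
  intro h d hd e i j
  rw [matBracket_apply, Finset.mul_sum, Finset.mul_sum]
  refine Finset.sum_congr rfl fun k _ => ?_
  have h1 := hx h d hd e
  have h2 := hy h d hd e
  linear_combination y k j * h1 i k + x i k * h2 k j -
    sgn ((par i + par k) * (par k + par j)) * (x k j * h2 i k + y i k * h1 k j)

/-- Invariance of the supertrace form, `([x, y], h) = φ(h) (x, y)`. It identifies the bracket of
opposite root vectors as a multiple of `t_α`. -/
theorem str_matBracket_mul_diagonal {φ : fixedCartan X m n → ℂ} {x : Mat X m n}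
    (hx : HasMatWeight φ x) (h : fixedCartan X m n) (y : Mat X m n) (d : Idx X m n → ℂ) (hd : Matrix.diagonal d ∈ linAlg X m n)
    (e : (h : FinAlg X m n) = Submodule.Quotient.mk ⟨Matrix.diagonal d, hd⟩) :
    str (matBracket x y * Matrix.diagonal d) = φ h * str (x * y) := by
  have h1 := hx h d hd e
  have hs : ∀ i k : Idx X m n,
      sgn (par i) * sgn ((par i + par k) * (par k + par i)) = sgn (par k) := by
    intro i k
    rcases zmod_two_cases (par i) with hi | hi <;> rcases zmod_two_cases (par k) with hk | hk <;>
      simp [hi, hk, sgn]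
    decide
  have key : str (matBracket x y * Matrix.diagonal d) =
      ∑ i, ∑ k, sgn (par i) * d i * (x i k * y k i) -
      ∑ i, ∑ k, sgn (par k) * d i * (x k i * y i k) := by
    rw [str_apply, ← Finset.sum_sub_distrib]
    refine Finset.sum_congr rfl fun i _ => ?_
    rw [Matrix.mul_diagonal, matBracket_apply, Finset.sum_mul, Finset.mul_sum,
      ← Finset.sum_sub_distrib]
    refine Finset.sum_congr rfl fun k _ => ?_
    rw [← hs i k]
    ring
  rw [key, Finset.sum_comm (f := fun i k => sgn (par k) * d i * (x k i * y i k)),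
    ← Finset.sum_sub_distrib, str_apply, Finset.mul_sum]
  refine Finset.sum_congr rfl fun i _ => ?_
  rw [← Finset.sum_sub_distrib, Matrix.mul_apply, Finset.mul_sum, Finset.mul_sum]
  refine Finset.sum_congr rfl fun k _ => ?_
  linear_combination sgn (par i) * y k i * h1 i k

/-! ### Weights -/

theorem weightForm_apply (lam α : Weight X m n) : weightForm lam α = lam (weightVec α) :=
  LinearMap.BilinForm.apply_toDual_symm_apply lam (weightVec α)

theorem cartanForm_weightVec (α : Weight X m n) (h : Cartan X m n) :
    cartanForm (weightVec α) h = α h :=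
  LinearMap.BilinForm.apply_toDual_symm_apply α h

theorem weightVec_smul (c : ℕ) (α : Weight X m n) : weightVec (c • α) = c • weightVec α :=
  map_nsmul _ _ _

/-- The form pairs `c` with `d`, so vanishing of `α` at `c` means that `t_α` has no `d`-component.
-/
theorem delta_weightVec {α : Weight X m n} (hα : ∀ r s : ℂ, α (0, r, s) = 0) :
    delta (weightVec α) = 0 := by
  have h := cartanForm_weightVec α (0, 1, 0)
  rw [hα, cartanForm_apply] at h
  simpa [delta] using h

theorem apply_eq_of_dotRoots {α : Weight X m n} (hα : ∀ r s : ℂ, α (0, r, s) = 0)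
    (h : Cartan X m n) : α h = α (h.1, 0, 0) := by
  have : h = (h.1, 0, 0) + (0, h.2.1, h.2.2) := by ext1 <;> simp
  conv_lhs => rw [this, map_add, hα, add_zero]

/-! ### The bracket of `ℒ` -/

theorem loopBracket_single_left (x : FinAlg X m n) (g : ℤ →₀ FinAlg X m n) (p : ℤ) :
    loopBracket (Finsupp.single 0 x) g p = finBracket x (g p) := by
  rw [loopBracket, Finsupp.sum_single_index (by simp), Finsupp.sum_apply]
  simp only [zero_add]
  rw [Finsupp.sum, Finset.sum_eq_single p]
  · simp
  · intro q _ hq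
    exact Finsupp.single_eq_of_ne hq.symm
  · intro h
    simp [Finsupp.notMem_support_iff.1 h]

theorem loopBracket_single_single (p q : ℤ) (x y : FinAlg X m n) :
    loopBracket (Finsupp.single p x) (Finsupp.single q y) =
      Finsupp.single (p + q) (finBracket x y) := by
  rw [loopBracket, Finsupp.sum_single_index (by simp), Finsupp.sum_single_index (by simp)]

theorem loopCocycle_single (p : ℤ) (x : FinAlg X m n) (g : ℤ →₀ FinAlg X m n) :
    loopCocycle (Finsupp.single p x) g = p * finForm x (g (-p)) := by
  rw [loopCocycle, Finsupp.sum_single_index (by simp)]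

theorem loopDeriv_single (p : ℤ) (x : FinAlg X m n) :
    loopDeriv (Finsupp.single p x) = Finsupp.single p ((p : ℂ) • x) := by
  rw [loopDeriv, Finsupp.sum_single_index (by simp)]

/-- The element `x ⊗ t ^ k` of `ℒ`. -/
def affSingle (k : ℤ) (x : FinAlg X m n) (hx : finSigma x = X.rootOfUnity ^ k • x) : Aff X m n :=
  ⟨(Finsupp.single k x, 0, 0), single_mem_affine hx 0 0⟩

theorem affSingle_ne_zero {k : ℤ} {x : FinAlg X m n}
    (hx : finSigma x = X.rootOfUnity ^ k • x) (h : x ≠ 0) : affSingle k x hx ≠ 0 := by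
  intro e
  have h1 := congrArg (fun z : Aff X m n => z.1.1 k) e
  simp only [affSingle, Finsupp.single_eq_same] at h1
  exact h h1

theorem affSingle_mem_affPart {k : ℤ} {x : FinAlg X m n} {a : ZMod 2}
    (hx : finSigma x = X.rootOfUnity ^ k • x) (h : x ∈ finPart a) :
    affSingle k x hx ∈ affPart a := by
  refine ⟨fun j => ?_, fun _ => rfl⟩
  change Finsupp.single k x j ∈ _
  rw [Finsupp.single_apply]
  split_ifs
  · exact h
  · exact zero_mem _

theorem affSingle_mem_rootSpace {k : ℤ} {x : FinAlg X m n}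
    (hx : finSigma x = X.rootOfUnity ^ k • x) {α : Weight X m n}
    (hα : ∀ r s : ℂ, α (0, r, s) = 0)
    (h : ∀ h : fixedCartan X m n, finBracket (h : FinAlg X m n) x = α (h, 0, 0) • x) :
    affSingle k x hx ∈ rootSpace (α + k • delta) := by
  intro c
  have hk : (α + k • delta : Weight X m n) c = α (c.1, 0, 0) + k * c.2.2 := by
    rw [LinearMap.add_apply, apply_eq_of_dotRoots hα]
    simp [delta]
  apply Subtype.ext
  refine Prod.ext ?_ (Prod.ext ?_ ?_)
  · change loopBracket (Finsupp.single 0 (c.1 : FinAlg X m n)) (Finsupp.single k x) +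
      c.2.2 • loopDeriv (Finsupp.single k x) - (0 : ℂ) • _ = _ • Finsupp.single k x
    rw [loopBracket_single_single, h, loopDeriv_single, hk, zero_add, zero_smul, sub_zero,
      Finsupp.smul_single, Finsupp.smul_single, ← Finsupp.single_add, smul_smul, add_smul,
      mul_comm c.2.2]
  · change loopCocycle (Finsupp.single 0 (c.1 : FinAlg X m n)) (Finsupp.single k x) = _ • (0 : ℂ)
    rw [loopCocycle_single]
    simp
  · change (0 : ℂ) = _ • (0 : ℂ)
    simp

theorem cartanIncl_mem_affPart (h : Cartan X m n) : cartanIncl h ∈ affPart 0 := by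
  refine ⟨fun k => ?_, fun h => absurd rfl h⟩
  change Finsupp.single 0 (h.1 : FinAlg X m n) k ∈ _
  rw [Finsupp.single_apply]
  split_ifs
  swap
  · exact zero_mem _
  obtain ⟨d, hd, e⟩ := exists_diagonal_eq h.1
  rw [e]
  refine ⟨⟨_, hd⟩, fun i j hij => ?_, rfl⟩
  refine Matrix.diagonal_apply_ne _ fun e => hij ?_
  rw [e]
  exact (by decide : ∀ a : ZMod 2, a + a = 0) _

/-! ### Root vectors -/

/-- A nonzero root space contains a nonzero homogeneous matrix times a power of `t`. -/
theorem exists_matrix {α : Weight X m n} (hα : α ∈ dotRealRoots X m n) :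
    ∃ (k : ℤ) (a : ZMod 2) (x : Mat X m n), x ∈ linAlg X m n ∧ x ≠ 0 ∧ x ∈ matPart a ∧
      (∀ i, x i i = 0) ∧ matSigma X m n x = X.rootOfUnity ^ k • x ∧
      HasMatWeight (fun h => α (h, 0, 0)) x := by
  obtain ⟨⟨hα0, k', z, hz, hz0⟩, hne⟩ := hα
  -- `(α, α) = α(t_α)`, and only the `𝔥`-component of `t_α` contributes.
  obtain ⟨h₀, hh₀⟩ : ∃ h : fixedCartan X m n, α (h, 0, 0) ≠ 0 := by
    refine ⟨(weightVec α).1, ?_⟩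
    rwa [← apply_eq_of_dotRoots hα0, ← weightForm_apply]
  have hk : ∀ h : fixedCartan X m n, (α + k' • delta : Weight X m n) (h, 0, 0) = α (h, 0, 0) := by
    intro h; simp [delta]
  have hz1 : ∀ (h : fixedCartan X m n) p, finBracket (h : FinAlg X m n) (z.1.1 p) = α (h, 0, 0) • z.1.1 p := by
    intro h p
    have h1 := congrArg (fun z : Aff X m n => z.1.1 p) (hz (h, 0, 0))
    have h2 : (loopBracket (Finsupp.single 0 (h : FinAlg X m n)) z.1.1 +
      (0 : ℂ) • loopDeriv z.1.1 -
        z.1.2.2 • loopDeriv (Finsupp.single 0 (h : FinAlg X m n))) p =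
        ((α + k' • delta : Weight X m n) (h, 0, 0)) • z.1.1 p := h1
    rw [loopDeriv_single, hk] at h2
    simpa [loopBracket_single_left] using h2
  have hz2 : z.1.2 = 0 := by
    have h1 := congrArg (fun z : Aff X m n => z.1.2) (hz (h₀, 0, 0))
    have h2 : (loopCocycle (Finsupp.single 0 (h₀ : FinAlg X m n)) z.1.1, (0 : ℂ)) =
        ((α + k' • delta : Weight X m n) (h₀, 0, 0)) • z.1.2 := h1
    rw [loopCocycle_single, hk, Int.cast_zero, zero_mul] at h2
    exact (smul_eq_zero.1 h2.symm).resolve_left hh₀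
  -- Only the action of `𝔥` is used from here on, so any nonzero coefficient will do and `k` is not
  -- compared with `k'`.
  obtain ⟨k, hk0⟩ : ∃ k, z.1.1 k ≠ 0 := by
    by_contra! h
    exact hz0 (Subtype.ext (Prod.ext (Finsupp.ext h) hz2))
  have hsig := z.2 k
  have hbr := fun h => hz1 h k
  obtain ⟨w, hw⟩ := Submodule.Quotient.mk_surjective _ (z.1.1 k)
  rw [← hw] at hk0 hsig
  simp only [← hw] at hbr
  -- normalize the representative so that its diagonal vanishes
  have hbr' : ∀ (h : fixedCartan X m n) (d : Idx X m n → ℂ)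
      (hd : Matrix.diagonal d ∈ linAlg X m n),
      (h : FinAlg X m n) = Submodule.Quotient.mk ⟨Matrix.diagonal d, hd⟩ →
      ∃ c : ℂ, matBracket (Matrix.diagonal d) w - α (h, 0, 0) • (w : Mat X m n) = c • 1 := by
    intro h d hd e
    have h1 := hbr h
    rw [e, finBracket_mk, ← Submodule.Quotient.mk_smul, Submodule.Quotient.eq] at h1
    exact exists_of_mem_scalars h1
  obtain ⟨d₀, hd₀, e₀⟩ := exists_diagonal_eq h₀
  obtain ⟨c₀, hc₀⟩ := hbr' h₀ d₀ hd₀ e₀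
  have hc₀' : c₀ • (1 : Mat X m n) ∈ linAlg X m n := by
    rw [← hc₀]
    exact sub_mem (bracket_mem_linAlg hd₀ w.2) (Submodule.smul_mem _ _ w.2)
  -- A bracket with a diagonal matrix has zero diagonal, so by `hc₀` every diagonal entry of `w`
  -- equals `-c₀ / α(h₀)`.
  set x : Mat X m n := w + (α (h₀, 0, 0))⁻¹ • c₀ • 1 with hx
  have hxl : x ∈ linAlg X m n := add_mem w.2 (Submodule.smul_mem _ _ hc₀')
  have hmk : (Submodule.Quotient.mk ⟨x, hxl⟩ : FinAlg X m n) = Submodule.Quotient.mk w := by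
    rw [Submodule.Quotient.eq]
    refine Submodule.mem_comap.2 (Submodule.mem_span_singleton.2
      ⟨(α (h₀, 0, 0))⁻¹ * c₀, ?_⟩)
    change _ = x - w
    rw [hx, mul_smul]
    abel
  have hdiag : ∀ i, x i i = 0 := by
    intro i
    have h1 := congrFun (congrFun hc₀ i) i
    rw [Matrix.sub_apply, matBracket_diagonal, sub_self, zero_mul, Matrix.smul_apply,
      Matrix.smul_apply, Matrix.one_apply_eq] at h1
    simp only [smul_eq_mul, mul_one, zero_sub] at h1
    simp only [hx, Matrix.add_apply, Matrix.smul_apply, Matrix.one_apply_eq, smul_eq_mul,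
      mul_one, ← h1]
    field_simp
    ring
  have hwt : HasMatWeight (fun h => α (h, 0, 0)) x := by
    intro h d hd e i j
    have h1 := hbr h
    rw [← hmk, e, finBracket_mk, ← Submodule.Quotient.mk_smul, Submodule.Quotient.eq] at h1
    obtain ⟨c, hc⟩ := exists_of_mem_scalars h1
    have h2 : matBracket (Matrix.diagonal d) x - α (h, 0, 0) • x = c • 1 := hc
    -- The scalar ambiguity of the quotient disappears because both matrices on the left of `h2`
    -- have zero diagonal. The same argument gives `hsx`.
    have hc0 : c = 0 := by
      have h3 := congrFun (congrFun h2 i) i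
      rw [Matrix.sub_apply, matBracket_diagonal] at h3
      simpa [hdiag] using h3.symm
    have h3 := congrFun (congrFun h2 i) j
    rw [Matrix.sub_apply, matBracket_diagonal, hc0] at h3
    simp only [Matrix.smul_apply, smul_eq_mul, zero_mul] at h3
    exact sub_eq_zero.1 h3
  have hsx : matSigma X m n x = X.rootOfUnity ^ k • x := by
    rw [← hmk, finSigma_mk, ← Submodule.Quotient.mk_smul, Submodule.Quotient.eq] at hsig
    obtain ⟨c, hc⟩ := exists_of_mem_scalars hsig
    have h2 : matSigma X m n x - X.rootOfUnity ^ k • x = c • 1 := hc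
    by_cases hI : IsEmpty (Idx X m n)
    · ext i; exact (hI.false i).elim
    obtain ⟨i⟩ := not_isEmpty_iff.1 hI
    have hc0 : c = 0 := by
      have h3 := congrFun (congrFun h2 i) i
      rw [Matrix.sub_apply, matSigma_diag_eq_zero hdiag] at h3
      simpa [hdiag] using h3.symm
    rw [hc0, zero_smul] at h2
    exact sub_eq_zero.1 h2
  have hx0 : x ≠ 0 := by
    intro h
    apply hk0
    rw [← hmk, Submodule.Quotient.mk_eq_zero]
    have : (⟨x, hxl⟩ : linAlg X m n) = 0 := Subtype.ext h
    rw [this]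
    exact zero_mem _
  obtain ⟨a, ha⟩ : ∃ a, homComponent a x ≠ 0 := by
    by_contra! h
    apply hx0
    ext i j
    have h1 := congrFun (congrFun (h (par i + par j)) i) j
    rwa [homComponent_apply, if_pos rfl] at h1
  have hd' : ∀ i, homComponent a x i i = 0 := fun i => by simp [homComponent_apply, hdiag]
  refine ⟨k, a, homComponent a x, ?_, ha, homComponent_mem a x, hd', ?_, ?_⟩
  · refine mem_linAlg_of_diag_eq_zero hd' fun hX => ?_
    rw [negAdjoint_homComponent, negAdjoint_eq_of_mem hX hxl]
  · rw [matSigma_homComponent, hsx, map_smul]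
  · intro h d hd e i j
    rw [homComponent_apply]
    split_ifs
    · exact hwt h d hd e i j
    · simp

theorem mk_ne_zero {x : Mat X m n} (hx : x ≠ 0) (hxl : x ∈ linAlg X m n) (hd : ∀ i, x i i = 0) :
    (Submodule.Quotient.mk ⟨x, hxl⟩ : FinAlg X m n) ≠ 0 := by
  intro h
  rw [Submodule.Quotient.mk_eq_zero] at h
  obtain ⟨c, hc⟩ := exists_of_mem_scalars h
  have hc : x = c • 1 := hc
  apply hx
  ext i j
  have h1 := congrFun (congrFun hc i) i
  rw [hd] at h1
  have hc0 : c = 0 := by simpa using h1.symm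
  rw [hc, hc0]
  simp

theorem finSigma_mk_smul {x : Mat X m n} (hxl : x ∈ linAlg X m n) {c : ℂ}
    (h : matSigma X m n x = c • x) :
    finSigma (Submodule.Quotient.mk ⟨x, hxl⟩) =
      c • (Submodule.Quotient.mk ⟨x, hxl⟩ : FinAlg X m n) := by
  rw [finSigma_mk, ← Submodule.Quotient.mk_smul]
  congr 1
  exact Subtype.ext h

/-- For a real root, homogeneous root vectors `e j`, `f j` of opposite weights, with the
`δ`-coefficient running through an arithmetic progression, whose bracket is a multiple of the
coroot modulo the centre. -/
theorem exists_rootVectors {α : Weight X m n} (hα : α ∈ dotRealRoots X m n) :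
    ∃ (k : ℤ) (a : ZMod 2) (κ : ℂ) (r : ℤ → ℂ) (e f : ℤ → Aff X m n), κ ≠ 0 ∧
      ∀ j, e j ∈ affPart a ∧ f j ∈ affPart a ∧ e j ≠ 0 ∧ f j ≠ 0 ∧
        e j ∈ rootSpace (α + (k + 4 * j) • delta) ∧
        f j ∈ rootSpace (-(α + (k + 4 * j) • delta)) ∧
        affBracket (e j) (f j) = cartanIncl (κ • weightVec α + (0, r j, 0)) := by
  obtain ⟨k, a, x, hxl, hx0, hxa, hxd, hxs, hxw⟩ := exists_matrix hα
  have hα0 := hα.1.1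
  set y := dagger x with hy
  have hyd : ∀ i, y i i = 0 := fun i => by rw [hy, dagger_apply, hxd]; simp
  have hyl : y ∈ linAlg X m n := mem_linAlg_of_diag_eq_zero hyd fun hX => by
    rw [hy, negAdjoint_dagger, negAdjoint_eq_of_mem hX hxl]
  have hys : matSigma X m n y = X.rootOfUnity ^ (-k) • y := by
    rw [hy, matSigma_dagger, hxs, dagger_smul, map_zpow₀, X.conj_rootOfUnity, inv_zpow, zpow_neg]
  have hyw : HasMatWeight (fun h => -α (h, 0, 0)) y := hxw.dagger
  have hya : y ∈ matPart a := dagger_mem_matPart hxa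
  have hs0 := str_mul_dagger_ne_zero hx0
  have hy0 : y ≠ 0 := by
    intro h
    rw [← hy, h] at hs0
    simp at hs0
  set M := matBracket x y with hM
  have hMl : M ∈ linAlg X m n := bracket_mem_linAlg hxl hyl
  have hMs : matSigma X m n M = M := by
    rw [hM, matSigma_bracket, hxs, hys, map_smul, map_smul, LinearMap.smul_apply, smul_smul,
      ← zpow_add₀ X.rootOfUnity_ne_zero, neg_add_cancel, zpow_zero, one_smul]
  have hMw : HasMatWeight (fun _ => 0) M := by
    have := hxw.matBracket hyw
    simpa using this
  have hMa : M ∈ matPart 0 := by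
    have := matBracket_mem_matPart hxa hya
    rwa [(by decide : ∀ a : ZMod 2, a + a = 0) a] at this
  have hMd := isDiag_of_hasMatWeight_zero hMw hMl hMa
  have hMf : (Submodule.Quotient.mk ⟨M, hMl⟩ : FinAlg X m n) ∈ fixedCartan X m n := by
    refine ⟨⟨⟨M, hMl⟩, hMd, rfl⟩, ?_⟩
    have := finSigma_mk_smul hMl (c := 1) (by rw [hMs, one_smul])
    rwa [one_smul] at this
  set t : fixedCartan X m n := ⟨_, hMf⟩ with ht
  set κ : ℂ := (1 / 2) * str (x * y) with hκ
  have hκ0 : κ ≠ 0 := mul_ne_zero (by norm_num) hs0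
  -- Both sides pair equally with all of `ℋ`, by invariance, and the form is nondegenerate.
  have htα : ((t, 0, 0) : Cartan X m n) = κ • weightVec α := by
    rw [← sub_eq_zero]
    refine eq_zero_of_cartanForm _ fun h => ?_
    rw [map_sub, LinearMap.sub_apply, map_smul, LinearMap.smul_apply, cartanForm_weightVec,
      apply_eq_of_dotRoots hα0, cartanForm_apply]
    obtain ⟨d, hd, e⟩ := exists_diagonal_eq h.1
    change finForm (Submodule.Quotient.mk ⟨M, hMl⟩) (h.1 : FinAlg X m n) + 0 * _ + 0 * _ - _ = 0
    rw [e, finForm_mk]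
    change 1 / 2 * str (matBracket x y * Matrix.diagonal d) + _ + _ - _ = _
    rw [str_matBracket_mul_diagonal hxw h.1 y d hd e, hκ, smul_eq_mul]
    ring
  have hxs' : ∀ j : ℤ, finSigma (Submodule.Quotient.mk ⟨x, hxl⟩) =
      X.rootOfUnity ^ (k + 4 * j) • (Submodule.Quotient.mk ⟨x, hxl⟩ : FinAlg X m n) := by
    intro j
    rw [X.rootOfUnity_zpow_add]
    exact finSigma_mk_smul hxl hxs
  have hys' : ∀ j : ℤ, finSigma (Submodule.Quotient.mk ⟨y, hyl⟩) =
      X.rootOfUnity ^ (-(k + 4 * j)) • (Submodule.Quotient.mk ⟨y, hyl⟩ : FinAlg X m n) := by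
    intro j
    rw [zpow_neg, X.rootOfUnity_zpow_add, ← zpow_neg]
    exact finSigma_mk_smul hyl hys
  -- The central coefficient `r j` is the value of the cocycle on `x ⊗ t ^ (k + 4j)` and `y ⊗ t ^
  -- (-(k + 4j))`.
  refine ⟨k, a, κ, fun j => ((k + 4 * j : ℤ) : ℂ) * finForm (Submodule.Quotient.mk ⟨x, hxl⟩)
    (Submodule.Quotient.mk ⟨y, hyl⟩), fun j => affSingle _ _ (hxs' j),
    fun j => affSingle _ _ (hys' j), hκ0, fun j => ⟨?_, ?_, ?_, ?_, ?_, ?_, ?_⟩⟩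
  · exact affSingle_mem_affPart _ ⟨⟨x, hxl⟩, hxa, rfl⟩
  · exact affSingle_mem_affPart _ ⟨⟨y, hyl⟩, hya, rfl⟩
  · exact affSingle_ne_zero _ (mk_ne_zero hx0 hxl hxd)
  · exact affSingle_ne_zero _ (mk_ne_zero hy0 hyl hyd)
  · exact affSingle_mem_rootSpace _ hα0 fun h => hxw.finBracket_mk hxl h
  · rw [neg_add, ← neg_smul]
    refine affSingle_mem_rootSpace _ (fun r s => ?_) fun h => hyw.finBracket_mk hyl h
    rw [LinearMap.neg_apply, hα0, neg_zero]
  · rw [← htα]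
    apply Subtype.ext
    refine Prod.ext ?_ (Prod.ext ?_ ?_)
    · change loopBracket (Finsupp.single (k + 4 * j) _) (Finsupp.single (-(k + 4 * j)) _) +
        (0 : ℂ) • _ - (0 : ℂ) • _ = Finsupp.single 0 ((t + 0 : fixedCartan X m n) : FinAlg X m n)
      rw [loopBracket_single_single, zero_smul, zero_smul, add_zero, sub_zero, add_neg_cancel,
        add_zero]
      rfl
    · change loopCocycle (Finsupp.single (k + 4 * j) _) (Finsupp.single (-(k + 4 * j)) _) = 0 + _
      rw [loopCocycle_single, Finsupp.single_eq_same, zero_add]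
    · change (0 : ℂ) = 0 + 0
      simp

/-! ### A nonvanishing criterion for `sl₂` -/

section SlTwo

open Polynomial

variable {V : Type*} [AddCommGroup V] [Module ℂ V]

/-- Operators `E`, `F` on a family of subspaces indexed by `ℤ` that satisfy the relations of
`sl₂`, the coroot acting by `b + 2 i` on the subspace of index `i`. -/
structure IsSlTwoFamily (E F : Module.End ℂ V) (W : ℤ → Submodule ℂ V) (b : ℂ) : Prop where
  raise : ∀ i, ∀ v ∈ W i, E v ∈ W (i + 1)
  lower : ∀ i, ∀ v ∈ W i, F v ∈ W (i - 1)
  comm : ∀ i, ∀ v ∈ W i, E (F v) - F (E v) = (b + 2 * i) • v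

namespace IsSlTwoFamily

variable {E F : Module.End ℂ V} {W : ℤ → Submodule ℂ V} {b : ℂ} (h : IsSlTwoFamily E F W b)

include h

theorem raise_pow (s : ℕ) {i : ℤ} {v : V} (hv : v ∈ W i) : (E ^ s) v ∈ W (i + s) := by
  induction s with
  | zero => simpa using hv
  | succ s ih =>
    rw [pow_succ', Module.End.mul_apply]
    have := h.raise _ _ ih
    rwa [add_assoc] at this

theorem lower_pow (s : ℕ) {i : ℤ} {v : V} (hv : v ∈ W i) : (F ^ s) v ∈ W (i - s) := by
  induction s with
  | zero => simpa using hv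
  | succ s ih =>
    rw [pow_succ', Module.End.mul_apply]
    have := h.lower _ _ ih
    rwa [sub_sub] at this

/-- Moving `E F` past powers of `F` changes it by a scalar. This and `FE_raise_pow` turn `E ^ s F ^
s` and `F ^ s E ^ s` on `W 0` into polynomials in the single operator `E F`, with explicit roots. -/
theorem EF_lower_pow (s : ℕ) {v : V} (hv : v ∈ W 0) :
    E (F ((F ^ s) v)) = (F ^ s) (E (F v) + (s * (b - s - 1)) • v) := by
  induction s with
  | zero => simp
  | succ s ih =>
    have h1 := h.comm _ _ (h.lower_pow (s + 1) hv)
    have h2 : ∀ z, F ((F ^ s) z) = (F ^ (s + 1)) z := fun z => by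
      rw [pow_succ', Module.End.mul_apply]
    rw [sub_eq_iff_eq_add.1 h1, ← h2 v, ih]
    simp only [h2]
    rw [← map_smul, ← map_add]
    congr 1
    push_cast
    module

theorem FE_raise_pow (s : ℕ) {v : V} (hv : v ∈ W 0) :
    F (E ((E ^ s) v)) = (E ^ s) (E (F v) - ((s + 1) * (b + s)) • v) := by
  induction s with
  | zero =>
    have h1 := h.comm 0 v hv
    rw [sub_eq_iff_eq_add] at h1
    simp [h1]
  | succ s ih =>
    have h1 := h.comm _ _ (h.raise_pow (s + 1) hv)
    have h2 : ∀ z, E ((E ^ s) z) = (E ^ (s + 1)) z := fun z => by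
      rw [pow_succ', Module.End.mul_apply]
    rw [sub_eq_iff_eq_add, ← sub_eq_iff_eq_add'] at h1
    rw [← h1, ← h2 v, ih]
    simp only [h2]
    rw [← map_smul, ← map_sub]
    congr 1
    push_cast
    module

theorem EF_mem {v : V} (hv : v ∈ W 0) : E (F v) ∈ W 0 := by
  simpa using h.raise _ _ (h.lower _ _ hv)

theorem raise_pow_lower_pow (s : ℕ) {v : V} (hv : v ∈ W 0) :
    (E ^ s) ((F ^ s) v) =
      aeval (E * F) (∏ j ∈ Finset.range s, (Polynomial.X - C (-(j * (b - j - 1)) : ℂ))) v := by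
  induction s generalizing v with
  | zero => simp
  | succ s ih =>
    have h1 : E (F v) + (s * (b - s - 1)) • v ∈ W 0 :=
      add_mem (h.EF_mem hv) (Submodule.smul_mem _ _ hv)
    rw [pow_succ E, pow_succ' F, Module.End.mul_apply, Module.End.mul_apply, h.EF_lower_pow s hv,
      ih h1, Finset.prod_range_succ, map_mul, Module.End.mul_apply]
    congr 1
    rw [map_sub, aeval_X, aeval_C, Algebra.algebraMap_eq_smul_one, LinearMap.sub_apply,
      LinearMap.smul_apply, Module.End.one_apply, Module.End.mul_apply]
    module

theorem lower_pow_raise_pow (s : ℕ) {v : V} (hv : v ∈ W 0) :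
    (F ^ s) ((E ^ s) v) =
      aeval (E * F) (∏ j ∈ Finset.range s, (Polynomial.X - C ((j + 1) * (b + j) : ℂ))) v := by
  induction s generalizing v with
  | zero => simp
  | succ s ih =>
    have h1 : E (F v) - ((s + 1) * (b + s)) • v ∈ W 0 :=
      sub_mem (h.EF_mem hv) (Submodule.smul_mem _ _ hv)
    rw [pow_succ F, pow_succ' E, Module.End.mul_apply, Module.End.mul_apply, h.FE_raise_pow s hv,
      ih h1, Finset.prod_range_succ, map_mul, Module.End.mul_apply]
    congr 1
    rw [map_sub, aeval_X, aeval_C, Algebra.algebraMap_eq_smul_one, LinearMap.sub_apply,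
      LinearMap.smul_apply, Module.End.one_apply, Module.End.mul_apply]

/-- If `E` acts nilpotently on a nonzero vector whose weight has real part at least `s`, then
`E ^ s F ^ s` does not kill this vector. -/
theorem raise_pow_lower_pow_ne_zero {v : V} (hv : v ∈ W 0) (hv0 : v ≠ 0) {N : ℕ}
    (hN : (E ^ N) v = 0) {s : ℕ} (hs : (s : ℝ) ≤ b.re) : (E ^ s) ((F ^ s) v) ≠ 0 := by
  intro h0
  apply hv0
  have h1 := h.lower_pow_raise_pow N hv
  rw [hN, map_zero] at h1
  rw [h.raise_pow_lower_pow s hv] at h0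
  -- A root of the first polynomial and a root of the second differ by `-(i + j + 1)(b + j - i)`
  -- with `i < s ≤ Re b`, which is nonzero.
  have hcop : IsCoprime (∏ j ∈ Finset.range s, (Polynomial.X - C (-(j * (b - j - 1)) : ℂ)))
      (∏ j ∈ Finset.range N, (Polynomial.X - C ((j + 1) * (b + j) : ℂ))) := by
    refine IsCoprime.prod_left fun i hi => IsCoprime.prod_right fun j _ => ?_
    refine isCoprime_X_sub_C_of_isUnit_sub (isUnit_iff_ne_zero.2 ?_)
    have e : (-(i * (b - i - 1)) : ℂ) - (j + 1) * (b + j) = -((i + j + 1 : ℕ) * (b + j - i)) := by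
      push_cast; ring
    rw [e]
    refine neg_ne_zero.2 (mul_ne_zero (Nat.cast_ne_zero.2 (by omega)) fun hb => ?_)
    have h2 := congrArg Complex.re hb
    simp only [Complex.sub_re, Complex.add_re, Complex.natCast_re, Complex.zero_re] at h2
    have h3 : (i : ℝ) < s := by exact_mod_cast Finset.mem_range.1 hi
    have h4 : (0 : ℝ) ≤ j := Nat.cast_nonneg j
    linarith
  -- Both polynomials in `E F` kill `v`, so by a Bézout relation the identity does too.
  obtain ⟨p, q, hpq⟩ := hcop
  have h2 : aeval (E * F) (1 : ℂ[X]) v = v := by rw [map_one, Module.End.one_apply]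
  rw [← hpq] at h2
  refine h2.symm.trans ?_
  rw [map_add (aeval (E * F)), map_mul (aeval (E * F)), map_mul (aeval (E * F)),
    LinearMap.add_apply, Module.End.mul_apply, Module.End.mul_apply, h0, ← h1, map_zero, map_zero,
    add_zero]

end IsSlTwoFamily

end SlTwo

/-! ### The action of root vectors on weight spaces -/

/-- The ratio `(lam, α) / (α, α)`. -/
def ratio (α : Weight X m n) : Weight X m n →ₗ[ℂ] ℂ :=
  (weightForm α α)⁻¹ • LinearMap.applyₗ (weightVec α)

theorem ratio_apply (α lam : Weight X m n) :
    ratio α lam = (weightForm α α)⁻¹ * weightForm lam α := by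
  rw [weightForm_apply lam]; rfl

theorem ratio_self {α : Weight X m n} (hα : α ∈ dotRealRoots X m n) :
    ratio α α = 1 := by
  rw [ratio_apply, inv_mul_cancel₀ hα.2]

/-- This is why uncontrolled multiples of `δ` do not affect the estimates of coroot values. -/
theorem ratio_delta {α : Weight X m n} (hα : α ∈ dotRealRoots X m n) :
    ratio α delta = 0 := by
  rw [ratio_apply, weightForm_apply delta, delta_weightVec hα.1.1, mul_zero]

namespace AffModule

variable {V : Type*} [AddCommGroup V] [Module ℂ V] (M : AffModule X m n V)

theorem act_mem_weightSpace {a : ZMod 2} {x : Aff X m n} (hx : x ∈ affPart a)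
    {ν lam : Weight X m n} (hν : x ∈ rootSpace ν) {v : V} (hv : v ∈ M.weightSpace lam) :
    M.act x v ∈ M.weightSpace (lam + ν) := by
  intro h
  have h1 := M.act_bracket 0 a _ (cartanIncl_mem_affPart h) x hx v
  rw [hν h, hv h, map_smul, map_smul, zero_mul] at h1
  have e : sgn 0 = 1 := by simp [sgn]
  rw [e, one_smul, LinearMap.smul_apply, eq_sub_iff_add_eq] at h1
  rw [← h1, LinearMap.add_apply, add_smul, add_comm]

theorem mem_supp {lam : Weight X m n} {v : V} (hv : v ∈ M.weightSpace lam) (h : v ≠ 0) :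
    lam ∈ M.supp := by
  intro e
  rw [e] at hv
  exact h hv

theorem exists_of_mem_supp {lam : Weight X m n} (h : lam ∈ M.supp) :
    ∃ v ∈ M.weightSpace lam, v ≠ 0 :=
  Submodule.exists_mem_ne_zero_of_ne_bot h

/-- Makes the central term `r j` of `exists_rootVectors` invisible, so that the coroot acts in the
same way for all `j`. -/
theorem weight_central (hlevel : M.IsZeroLevel) {lam : Weight X m n} {v : V}
    (hv : v ∈ M.weightSpace lam) (h : v ≠ 0) (r : ℂ) : lam (0, r, 0) = 0 := by
  have h1 := hv (0, r, 0)
  have h2 : cartanIncl (0, r, 0) = r • (central : Aff X m n) := by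
    apply Subtype.ext
    refine Prod.ext ?_ (Prod.ext ?_ ?_)
    · change Finsupp.single 0 (0 : FinAlg X m n) = r • 0
      simp
    · change r = r * 1
      simp
    · change (0 : ℂ) = r * 0
      simp
  have h3 : M.act central = 0 := hlevel
  rw [h2, map_smul, h3, smul_zero, LinearMap.zero_apply] at h1
  exact (smul_eq_zero.1 h1.symm).resolve_right h

/-- For a real root `α` there are `sl₂`-pairs of operators that shift weights by multiples of
`c α + k δ`, where `c = 1` or `c = 2` and `k` runs through an arithmetic progression. -/
theorem exists_slTwo (hlevel : M.IsZeroLevel) {α : Weight X m n} (hα : α ∈ dotRealRoots X m n) :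
    ∃ (c p : ℕ) (q : ℤ) (E F : ℤ → Module.End ℂ V), 0 < c ∧ 0 < p ∧
      (∀ j lam, IsSlTwoFamily (E j) (F j)
        (fun i => M.weightSpace (lam + i • (c • α + (q + p * j) • delta)))
        (2 / c * ratio α lam)) ∧
      (M.FullLocallyNilpotent α → ∀ j v, ∃ N, (E j ^ N) v = 0) := by
  obtain ⟨k, a, κ, r, e, f, hκ, hef⟩ := exists_rootVectors hα
  set A : ℂ := κ * weightForm α α with hA
  have hA0 : A ≠ 0 := mul_ne_zero hκ hα.2
  have hwf : weightForm α α ≠ 0 := hα.2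
  clear_value A
  have hmemE : ∀ j lam v, v ∈ M.weightSpace lam →
      M.act (e j) v ∈ M.weightSpace (lam + (α + (k + 4 * j) • delta)) := fun j lam v hv =>
    M.act_mem_weightSpace (hef j).1 (hef j).2.2.2.2.1 hv
  have hmemF : ∀ j lam v, v ∈ M.weightSpace lam →
      M.act (f j) v ∈ M.weightSpace (lam - (α + (k + 4 * j) • delta)) := fun j lam v hv => by
    rw [sub_eq_add_neg]
    exact M.act_mem_weightSpace (hef j).2.1 (hef j).2.2.2.2.2.1 hv
  have hcomm : ∀ j lam v, v ∈ M.weightSpace lam →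
      M.act (e j) (M.act (f j) v) - sgn (a * a) • M.act (f j) (M.act (e j) v) =
        (A * ratio α lam) • v := by
    intro j lam v hv
    rw [← M.act_bracket a a _ (hef j).1 _ (hef j).2.1, (hef j).2.2.2.2.2.2, hv]
    by_cases h0 : v = 0
    · simp [h0]
    · rw [map_add, M.weight_central hlevel hv h0, map_smul, ratio_apply, hA, weightForm_apply lam,
        add_zero, smul_eq_mul]
      congr 1
      field_simp
  have hnil : M.FullLocallyNilpotent α → ∀ j v, ∃ N, (M.act (e j) ^ N) v = 0 := by
    intro hF j v
    obtain ⟨-, -, he0, -, he, -⟩ := hef j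
    exact (hF.2 _ ⟨_, he, he0⟩).2 _ he he0 v
  have hr : ∀ j lam, ratio α (lam + (α + (k + 4 * j) • delta)) = ratio α lam + 1 := by
    intro j lam
    rw [map_add, map_add, map_zsmul, ratio_self hα, ratio_delta hα, smul_zero, add_zero]
  have hr' : ∀ (c j i : ℤ) lam, ratio α (lam + i • (c • α + j • delta)) =
      ratio α lam + i * c := by
    intro c j i lam
    rw [map_add, map_zsmul, map_add, map_zsmul, map_zsmul, ratio_self hα, ratio_delta hα]
    simp
  -- Even root vectors form an `sl₂`-pair after rescaling. Odd ones generate a copy of `osp(1|2)`,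
  -- whose even part is spanned by the squares and the coroot.
  rcases zmod_two_cases a with ha | ha
  · refine ⟨1, 4, k, fun j => (2 / A) • M.act (e j), fun j => M.act (f j), one_pos, by norm_num,
      fun j lam => ⟨fun i v hv => ?_, fun i v hv => ?_, fun i v hv => ?_⟩, fun hF j v => ?_⟩
    · refine Submodule.smul_mem _ _ ?_
      convert hmemE j _ v hv using 2
      push_cast
      module
    · convert hmemF j _ v hv using 2
      push_cast
      module
    · have h1 := hcomm j _ v hv
      have e2 : sgn 0 = 1 := by simp [sgn]
      rw [ha, mul_zero, e2, one_smul] at h1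
      rw [LinearMap.smul_apply, LinearMap.smul_apply, map_smul, ← smul_sub, h1, smul_smul]
      congr 1
      have h2 := hr' 1 (k + 4 * j) i lam
      push_cast at h2 ⊢
      rw [one_smul] at h2 ⊢
      rw [h2]
      field_simp
    · obtain ⟨N, hN⟩ := hnil hF j v
      exact ⟨N, by rw [smul_pow, LinearMap.smul_apply, hN, smul_zero]⟩
  · have e3 : sgn (a * a) = -1 := by simp [ha, sgn]
    refine ⟨2, 8, 2 * k, fun j => (-(A ^ 2)⁻¹) • M.act (e j) ^ 2, fun j => M.act (f j) ^ 2,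
      two_pos, by norm_num,
      fun j lam => ⟨fun i v hv => ?_, fun i v hv => ?_, fun i v hv => ?_⟩, fun hF j v => ?_⟩
    · refine Submodule.smul_mem _ _ ?_
      rw [pow_two, Module.End.mul_apply]
      convert hmemE j _ _ (hmemE j _ v hv) using 2
      push_cast
      module
    · change (M.act (f j) ^ 2) v ∈ _
      rw [pow_two, Module.End.mul_apply]
      convert hmemF j _ _ (hmemF j _ v hv) using 2
      push_cast
      module
    · set mu := lam + i • (2 • α + (2 * k + (8 : ℕ) * j) • delta) with hmu
      clear_value mu
      have hc : ∀ lam v, v ∈ M.weightSpace lam →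
          M.act (e j) (M.act (f j) v) =
            (A * ratio α lam) • v - M.act (f j) (M.act (e j) v) := by
        intro lam v hv
        have h1 := hcomm j lam v hv
        rw [e3, neg_smul, one_smul, sub_neg_eq_add] at h1
        rw [← h1, add_sub_cancel_right]
      -- Raising by `e j` increases the coroot value by `A`, so `e²f - fe² = -A e`. Applying this
      -- twice gives `e²f² - f²e² = -A² ratio`, whence the factor `-(A²)⁻¹` in `E`.
      have h1 : ∀ lam v, v ∈ M.weightSpace lam →
          M.act (e j) (M.act (e j) (M.act (f j) v)) =
            -A • M.act (e j) v + M.act (f j) (M.act (e j) (M.act (e j) v)) := by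
        intro lam v hv
        rw [hc lam v hv, map_sub, map_smul, hc _ _ (hmemE j _ v hv), hr]
        module
      have h2 : M.act (e j) (M.act (e j) (M.act (f j) (M.act (f j) v))) =
          (-(A ^ 2) * ratio α mu) • v +
            M.act (f j) (M.act (f j) (M.act (e j) (M.act (e j) v))) := by
        rw [h1 _ _ (hmemF j _ v hv), h1 _ _ hv, hc _ _ hv, (M.act (f j)).map_add,
          (M.act (f j)).map_smul]
        module
      have h3 : ratio α mu = ratio α lam + i * 2 := by
        have := hr' 2 (2 * k + (8 : ℕ) * j) i lam
        rw [hmu]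
        exact_mod_cast this
      simp only [pow_two (M.act _), LinearMap.smul_apply, Module.End.mul_apply, map_smul]
      rw [h2, smul_add, add_sub_cancel_right, smul_smul, h3]
      congr 1
      field_simp
      push_cast
      ring
    · obtain ⟨N, hN⟩ := hnil hF j v
      refine ⟨N, ?_⟩
      rw [smul_pow, LinearMap.smul_apply, ← pow_mul, mul_comm 2 N, pow_mul,
        pow_two (M.act (e j) ^ N), Module.End.mul_apply, hN, map_zero, smul_zero]

/-- Some root vector of weight `-β + k δ` acts injectively if `β` is hybrid. -/
theorem exists_injective_of_hybrid {β : Weight X m n} (hβ : M.Hybrid β) :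
    ∃ (k : ℤ) (T : Module.End ℂ V), Function.Injective T ∧
      ∀ lam, ∀ v ∈ M.weightSpace lam, T v ∈ M.weightSpace (lam - (β + k • delta)) := by
  have hβ' : β ∈ dotRealRoots X m n := by
    rcases hβ with h | h
    exacts [h.1, h.1]
  obtain ⟨k, a, κ, r, e, f, hκ, hef⟩ := exists_rootVectors hβ'
  suffices h : ∃ j, Function.Injective (M.act (f j)) by
    obtain ⟨j, hj⟩ := h
    refine ⟨k + 4 * j, M.act (f j), hj, fun lam v hv => ?_⟩
    rw [sub_eq_add_neg]
    exact M.act_mem_weightSpace (hef j).2.1 (hef j).2.2.2.2.2.1 hv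
  -- Both hybrid patterns make the roots over `-β` injective on a half-line of `δ`-coefficients, and
  -- the progression of the `f j` meets each half-line.
  have key : ∀ r j : ℤ, -(β + (k + 4 * j) • delta) =
      -(β + r • delta) + (r - (k + 4 * j)) • delta := fun r j => by module
  rcases hβ with ⟨-, r, t, ht, h⟩ | ⟨-, r, t, ht, h⟩
  · obtain ⟨j, hj⟩ : ∃ j : ℤ, t ≤ r - (k + 4 * j) := ⟨-(|t| + |r| + |k|), by
      have := le_abs_self t; have := neg_abs_le r; have := le_abs_self k
      have := abs_nonneg t; have := abs_nonneg r; have := abs_nonneg k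
      linarith⟩
    obtain ⟨-, -, -, hf0, -, hf, -⟩ := hef j
    refine ⟨j, ?_⟩
    rw [key r] at hf
    exact (((h _).2 ⟨_, hf, hf0⟩).1 hj).2 _ hf hf0
  · obtain ⟨j, hj⟩ : ∃ j : ℤ, r - (k + 4 * j) ≤ -t := ⟨|t| + |r| + |k|, by
      have := le_abs_self t; have := le_abs_self r; have := neg_abs_le k
      have := abs_nonneg t; have := abs_nonneg r; have := abs_nonneg k
      linarith⟩
    obtain ⟨-, -, -, hf0, -, hf, -⟩ := hef j
    refine ⟨j, ?_⟩
    rw [key r] at hf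
    exact (((h _).2 ⟨_, hf, hf0⟩).1 hj).2 _ hf hf0

/-! ### Rays in the support modulo `ℤδ` -/

/-- The weights `mu + s d γ` lie in the support modulo `ℤ δ`, for some `d > 0` and all large
`s`. -/
def HasUnboundedRay (mu γ : Weight X m n) : Prop :=
  ∃ d N : ℕ, 0 < d ∧ ∀ s, N ≤ s → ∃ k : ℤ, mu + (s * d) • γ + k • delta ∈ M.supp

theorem lower_pow_mem_supp {α lam : Weight X m n} {c : ℕ} {k : ℤ} {E F : Module.End ℂ V}
    (h : IsSlTwoFamily E F (fun i => M.weightSpace (lam + i • (c • α + k • delta)))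
      (2 / c * ratio α lam)) {v : V} (hv : v ∈ M.weightSpace lam) (hv0 : v ≠ 0)
    (hE : ∃ N, (E ^ N) v = 0) {s : ℕ} (hs : (s : ℝ) ≤ (2 / c * ratio α lam).re) :
    (E ^ s) ((F ^ s) v) ≠ 0 ∧
      (F ^ s) v ∈ M.weightSpace (lam - s • (c • α + k • delta)) := by
  obtain ⟨N, hN⟩ := hE
  have hv' : v ∈ M.weightSpace (lam + (0 : ℤ) • (c • α + k • delta)) := by
    rwa [zero_smul, add_zero]
  refine ⟨h.raise_pow_lower_pow_ne_zero hv' hv0 hN hs, ?_⟩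
  convert h.lower_pow s hv' using 2
  module

/-- Vectors far out on the ray can be lowered to finitely many fixed weight spaces near `mu`, and
would have to survive arbitrarily high powers of `E 0` there. -/
theorem not_hasUnboundedRay (hlevel : M.IsZeroLevel)
    (hfin : ∀ lam, FiniteDimensional ℂ (M.weightSpace lam)) {α : Weight X m n}
    (hα : M.FullLocallyNilpotent α) (mu : Weight X m n) : ¬ M.HasUnboundedRay mu α := by
  rintro ⟨d, N₀, hd, h⟩
  obtain ⟨c, p, q, E, F, hc, hp, hsl, hnil⟩ := M.exists_slTwo hlevel hα.1
  replace hnil := hnil hα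
  -- Local nilpotency becomes uniform on a finite dimensional weight space.
  have hkill : ∀ lam, ∃ N, ∀ s, N ≤ s → ∀ v ∈ M.weightSpace lam, (E 0 ^ s) v = 0 := by
    intro lam
    obtain ⟨S, hS⟩ := Module.Finite.iff_fg.1 (hfin lam)
    choose N hN using hnil 0
    refine ⟨S.sup N, fun s hs v hv => ?_⟩
    have hle : M.weightSpace lam ≤ LinearMap.ker (E 0 ^ s) := by
      rw [← hS, Submodule.span_le]
      intro w hw
      have : N w ≤ s := (Finset.le_sup hw).trans hs
      rw [SetLike.mem_coe, LinearMap.mem_ker, ← Nat.sub_add_cancel this, pow_add,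
        Module.End.mul_apply, hN, map_zero]
    exact hle hv
  choose N hN using hkill
  set N₁ := (Finset.range p).sup fun i => N (mu + (i : ℤ) • delta) with hN₁
  obtain ⟨B, hB⟩ := exists_nat_ge (-(2 / c * ratio α mu).re)
  -- The index exceeds `N₀`, so the ray is available. It also gives `l ≥ N₁`, which contradicts
  -- `hN`, and `l ≥ B`, so that the coroot value at `mu + l c α`, of real part at least `2l - B`, is
  -- at least `l`.
  set s := N₀ + N₁ + B + 1 with hs
  obtain ⟨k, hk⟩ := h (s * c) (by nlinarith)
  set l := s * d - 1 with hl
  have hsd : s * d = l + 1 := by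
    have : 0 < s * d := Nat.mul_pos (by omega) hd
    omega
  have hsl1 : s ≤ l + 1 := by rw [← hsd]; exact Nat.le_mul_of_pos_right _ hd
  have hsd' : s * c * d = (l + 1) * c := by rw [← hsd]; ring
  rw [hsd'] at hk
  have hc0 : (c : ℂ) ≠ 0 := Nat.cast_ne_zero.2 hc.ne'
  have hre : ∀ (i : ℕ) (k : ℤ), (2 / c * ratio α (mu + (i * c) • α + k • delta)).re =
      (2 / c * ratio α mu).re + 2 * i := by
    intro i k
    rw [map_add, map_add, map_nsmul, map_zsmul, ratio_self hα.1, ratio_delta hα.1]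
    have : 2 / (c : ℂ) * (ratio α mu + (i * c) • (1 : ℂ) + k • (0 : ℂ)) =
        2 / c * ratio α mu + ((2 * i : ℝ) : ℂ) := by
      push_cast
      rw [nsmul_eq_mul]
      push_cast
      field_simp
      simp
    rw [this, Complex.add_re, Complex.ofReal_re]
  have hlR : (B : ℝ) ≤ l := by exact_mod_cast (by omega : B ≤ l)
  -- one step, to change the coefficient of `δ`
  obtain ⟨v, hv, hv0⟩ := M.exists_of_mem_supp hk
  -- Division with remainder: `F j` removes `q + pj` from the `δ`-coefficient `k`, leaving `i + lq`
  -- with `0 ≤ i < p`, and `l` applications of `F 0` then remove `lq`.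
  set j := (k - (l + 1) * q) / p with hj
  have step1 := M.lower_pow_mem_supp (hsl j _) hv hv0 (hnil j v) (s := 1) (by
    rw [hre]; push_cast; linarith)
  have hw0 : (F j ^ 1) v ≠ 0 := fun e => step1.1 (by rw [e, map_zero])
  obtain ⟨i, hi⟩ : ∃ i : ℕ, (i : ℤ) = (k - (l + 1) * q) % p :=
    ⟨_, Int.toNat_of_nonneg (Int.emod_nonneg _ (by exact_mod_cast hp.ne'))⟩
  have hip : i < p := by
    have := Int.emod_lt_of_pos (k - (l + 1) * q) (by exact_mod_cast hp : (0 : ℤ) < p)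
    omega
  have hdiv : k = i + p * j + (l + 1) * q := by
    have := Int.emod_add_mul_ediv (k - (l + 1) * q) p
    rw [← hi, ← hj] at this
    linarith
  have hw := step1.2
  have ew : mu + ((l + 1) * c) • α + k • delta - 1 • (c • α + (q + p * j) • delta) =
      mu + (l * c) • α + (i + l * q) • delta := by
    rw [hdiv]; module
  rw [ew] at hw
  -- `l` further steps, into one of finitely many weight spaces
  have step2 := M.lower_pow_mem_supp (hsl 0 _) hw hw0 (hnil 0 _) (s := l) (by
    rw [hre]; linarith)
  have eu : mu + (l * c) • α + (i + l * q) • delta - l • (c • α + (q + p * 0) • delta) =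
      mu + (i : ℤ) • delta := by module
  rw [eu] at step2
  refine step2.1 (hN _ _ ?_ _ step2.2)
  have h1 : N (mu + (i : ℤ) • delta) ≤ N₁ :=
    Finset.le_sup (f := fun i : ℕ => N (mu + (i : ℤ) • delta)) (Finset.mem_range.2 hip)
  omega

/-- The component of the ray along `β` is cancelled, by an injective root vector or by lowering
operators of an `sl₂`-pair. The lowering operators move in steps of `cβ`, so the period `d` is
replaced by `cd` in the second case. -/
theorem HasUnboundedRay.of_add (hlevel : M.IsZeroLevel) {α β mu : Weight X m n}
    (horth : weightForm α β = 0) (hβ : M.Hybrid β ∨ M.FullLocallyNilpotent β)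
    (h : M.HasUnboundedRay mu (α + β)) : M.HasUnboundedRay mu α := by
  obtain ⟨d, N, hd, h⟩ := h
  rcases hβ with hβ | hβ
  · obtain ⟨q, T, hT, hTw⟩ := M.exists_injective_of_hybrid hβ
    refine ⟨d, N, hd, fun s hs => ?_⟩
    obtain ⟨k, hk⟩ := h s hs
    obtain ⟨v, hv, hv0⟩ := M.exists_of_mem_supp hk
    have hpow : ∀ i : ℕ, (T ^ i) v ≠ 0 ∧ (T ^ i) v ∈
        M.weightSpace (mu + (s * d) • (α + β) + k • delta - i • (β + q • delta)) := by
      intro i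
      induction i with
      | zero =>
        rw [pow_zero, Module.End.one_apply, zero_smul, sub_zero]
        exact ⟨hv0, hv⟩
      | succ i ih =>
        rw [pow_succ', Module.End.mul_apply]
        refine ⟨fun e => ih.1 (hT (by rw [e, map_zero])), ?_⟩
        convert hTw _ _ ih.2 using 2
        module
    refine ⟨k - (s * d : ℕ) * q, M.mem_supp ?_ (hpow (s * d)).1⟩
    convert (hpow (s * d)).2 using 2
    module
  · obtain ⟨c, p, q, E, F, hc, hp, hsl, hnil⟩ := M.exists_slTwo hlevel hβ.1
    obtain ⟨B, hB⟩ := exists_nat_ge (-(2 / c * ratio β mu).re)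
    refine ⟨c * d, N + B, Nat.mul_pos hc hd, fun s hs => ?_⟩
    obtain ⟨k, hk⟩ := h (s * c) (by nlinarith)
    obtain ⟨v, hv, hv0⟩ := M.exists_of_mem_supp hk
    have hc0 : (c : ℂ) ≠ 0 := Nat.cast_ne_zero.2 hc.ne'
    have hαβ : ratio β α = 0 := by rw [ratio_apply, horth, mul_zero]
    -- Orthogonality removes the contribution of `α`. The `scd` copies of `β` add `2sd` to the
    -- coroot value, which beats the `sd` steps needed once `sd ≥ B`.
    have hre : (2 / c * ratio β (mu + (s * c * d) • (α + β) + k • delta)).re =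
        (2 / c * ratio β mu).re + 2 * (s * d : ℕ) := by
      rw [map_add, map_add, map_nsmul, map_zsmul, map_add, hαβ, ratio_self hβ.1,
        ratio_delta hβ.1]
      have : 2 / (c : ℂ) * (ratio β mu + (s * c * d) • (0 + 1 : ℂ) + k • (0 : ℂ)) =
          2 / c * ratio β mu + ((2 * (s * d : ℕ) : ℝ) : ℂ) := by
        rw [nsmul_eq_mul]
        push_cast
        field_simp
        simp
      rw [this, Complex.add_re, Complex.ofReal_re]
    have hBs : (B : ℝ) ≤ (s * d : ℕ) := by
      exact_mod_cast (by nlinarith : B ≤ s * d)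
    have step := M.lower_pow_mem_supp (hsl 0 _) hv hv0 (hnil hβ 0 v) (s := s * d) (by
      rw [hre]; linarith)
    have hne : (F 0 ^ (s * d)) v ≠ 0 := fun e => step.1 (by rw [e, map_zero])
    refine ⟨k - (s * d : ℕ) * q, M.mem_supp ?_ hne⟩
    convert step.2 using 2
    module

end AffModule

end TwistedAffine

end

theorem mainTheorem6 (X : TwistedAffine.Family) (m n : ℕ) (hX : X.Admissible m n)
    {V : Type*} [AddCommGroup V] [Module ℂ V] (M : TwistedAffine.AffModule X m n V)
    (hsimple : M.IsSimple) (hfin : M.IsFiniteWeight) (hlevel : M.IsZeroLevel)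
    (ϱ : ℕ) (hϱ : ϱ = 1 ∨ ϱ = 2) (α β : TwistedAffine.Weight X m n)
    (hα : ϱ • α ∈ TwistedAffine.dotRoots X m n) (hβ : ϱ • β ∈ TwistedAffine.dotRoots X m n)
    (horth : TwistedAffine.weightForm α β = 0)
    (hα_pos : M.FullLocallyNilpotent (ϱ • α)) (hα_neg : M.FullLocallyNilpotent (-(ϱ • α)))
    (hβ_pos : M.Hybrid (ϱ • β) ∨ M.FullLocallyNilpotent (ϱ • β))
    (hβ_neg : M.Hybrid (-(ϱ • β)) ∨ M.FullLocallyNilpotent (-(ϱ • β))) :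
    ¬ ∃ μ ∈ M.supp, ∃ k : ℕ → ℤ, ∀ s : ℕ, 0 < s →
      μ + s • (α + β) + k s • TwistedAffine.delta ∈ M.supp := by
  rintro ⟨μ, -, k, h⟩
  -- Only `ϱα` and `ϱβ` are roots, so the given ray is sampled at the multiples of `ϱ`.
  refine M.not_hasUnboundedRay hlevel hfin.2 hα_pos μ
    (TwistedAffine.AffModule.HasUnboundedRay.of_add M hlevel ?_ hβ_pos
      ⟨1, 1, one_pos, fun s hs => ⟨k (s * ϱ), ?_⟩⟩)
  · rw [TwistedAffine.weightForm_apply] at horth ⊢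
    rw [TwistedAffine.weightVec_smul, map_nsmul, LinearMap.smul_apply, horth, smul_zero, smul_zero]
  · rw [mul_one]
    have h1 := h (s * ϱ) (Nat.mul_pos hs (by omega))
    rwa [mul_smul, smul_add] at h1
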